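/- Let $\mathbb F_q$ be a finite field with $q$ elements, $A=\mathbb F_q[\theta]$, $K=\mathbb F_q(\theta)$, and let $A_{+,d}$ denote the set of monic polynomials of degree $d$ in $A$. Put $D_0=1$ and $D_i=(\theta^{q^i}-\theta)D_{i-1}^q$ for $i\ge 1$. Let $s\ge 1$ be an integer. On $K[t_1,\dots,t_s][[z]]$ let $\varphi$ raise the coefficients in $K$ to the power $q$ (fixing $t_1,\dots,t_s,z$), let $\tau_z=z(t_1-\theta)\cdots(t_s-\theta)\varphi$ and $\exp_z=\sum_{j\ge0}\frac1{D_j}\tau_z^j$, and set \[\sigma_s=\exp_z\Big(\sum_{d\ge 0}z^d\sum_{a\in A_{+,d}}\frac{a(t_1)\cdots a(t_s)}{a}\Big)\in K[t_1,\dots,t_s][[z]].\] For $a\in A$ let $C_a$ be the Carlitz action: $a\mapsto C_a$ is the $\mathbb F_q$-algebra homomorphism from $A$ to the $\mathbb F_q$-linear polynomials in one variable over $A$ (under composition) with $C_\theta(X)=\theta X+X^q$. With $\exp_C(f)=\sum_{j\ge 0}\frac1{D_j}f^{q^j}$ for $f\in Z\,K[X_1,\dots,X_s][[Z]]$, set \[\mathbb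 S_s(X_1,\dots,X_s,Z)=\exp_C\Big(\sum_{d\ge0}Z^{q^d}\sum_{a\in A_{+,d}}\frac{C_a(X_1)\cdots C_a(X_s)}{a}\Big)\in K[X_1,\dots,X_s][[Z]].\] Then $\sigma_s\in A[t_1,\dots,t_s,z]$ and $\mathbb S_s\in A[X_1,\dots,X_s,Z]$, and: 1. $\deg_z\sigma_s\le\dfrac{s-1}{q-1}$. 2. The following are equivalent: (a) $z-1$ divides $\sigma_s$ in $A[t_1,\dots,t_s,z]$; (b) $\mathbb S_s(X_1,\dots,X_s,1)=0$; (c) $s>1$ and $s\equiv 1\pmod{q-1}$. -/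

import Mathlib

open Polynomial

noncomputable section

namespace AndersonStark

variable (F : Type*) [Field F] [Fintype F]

/-- There are finitely many monic polynomials of a given degree over a finite field. -/
theorem finite_monic (d : ℕ) : {a : F[X] | a.Monic ∧ a.natDegree = d}.Finite := by
  classical
  refine Set.Finite.of_finite_image (f := fun a : F[X] => fun i : Fin (d + 1) => a.coeff i)
    (Set.toFinite _) ?_
  rintro a ⟨-, ha⟩ b ⟨-, hb⟩ hab
  ext i
  by_cases hi : i < d + 1
  · exact congrFun hab ⟨i, hi⟩
  · rw [coeff_eq_zero_of_natDegree_lt (by omega), coeff_eq_zero_of_natDegree_lt (by omega)]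

/-- The finite set `A_{+,d}` of monic polynomials of degree `d` in `A = F[θ]`.
The indeterminate `θ` of `A` is the variable `X` of `F[X]`. -/
def monics (d : ℕ) : Finset F[X] := (finite_monic F d).toFinset

theorem mem_monics (d : ℕ) (a : F[X]) : a ∈ monics F d ↔ a.Monic ∧ a.natDegree = d := by
  simp [monics]

/-- `D_0 = 1` and `D_i = (θ^{q^i} - θ) D_{i-1}^q`. -/
def carlitzD : ℕ → F[X]
  | 0 => 1
  | i + 1 => (X ^ Fintype.card F ^ (i + 1) - X) * carlitzD i ^ Fintype.card F

/-- The polynomial ring `K[Y_1, …, Y_s]` over `K = F(θ)`; the variables play the role of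
`t_1, …, t_s` or of `X_1, …, X_s`. -/
abbrev KPoly (s : ℕ) : Type _ := MvPolynomial (Fin s) (RatFunc F)

/-- The inclusion `A[Y_1, …, Y_s] ⊆ K[Y_1, …, Y_s]`. -/
def incl (s : ℕ) : MvPolynomial (Fin s) F[X] →+* KPoly F s :=
  MvPolynomial.map (algebraMap F[X] (RatFunc F))

/-- The constant `1 / a` of `K[Y_1, …, Y_s]`, for `a` in `A`. -/
def invC (s : ℕ) (a : F[X]) : KPoly F s :=
  MvPolynomial.C (algebraMap F[X] (RatFunc F) a)⁻¹

/-- The Carlitz action of `A` on a commutative `A`-algebra `M`: the homomorphism of `F`-algebras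
`a ↦ C_a` from `A` to the `F`-linear endomorphisms of `M` with `C_θ(m) = θ m + m ^ q`. -/
def carlitz (M : Type*) [CommRing M] [Algebra F M] [Algebra F[X] M] :
    F[X] →ₐ[F] Module.End F M :=
  Polynomial.aeval (LinearMap.mulLeft F (algebraMap F[X] M X) +
    (FiniteField.frobeniusAlgHom F M).toLinearMap)

/-- `a * G = G(C_a(X_1), …, C_a(X_s))`. -/
def star (s : ℕ) (a : F[X]) (G : KPoly F s) : KPoly F s :=
  MvPolynomial.aeval (fun i => carlitz F (KPoly F s) a (MvPolynomial.X i)) G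

/-- `L_k(G) = ∑_{a ∈ A_{+,k}} (a * G) / a`. -/
def bigL (s : ℕ) (G : KPoly F s) (k : ℕ) : KPoly F s :=
  ∑ a ∈ monics F k, invC F s a * star F s a G

/-- `l(G, Z) = ∑_{a ∈ A_+} (a * (G Z)) / a = ∑_{k ≥ 0} L_k(G) Z^{q^k}`, as a power series in `Z`
(`q ^ k = n` forces `k ≤ n`). -/
def littleL (s : ℕ) (G : KPoly F s) : PowerSeries (KPoly F s) :=
  PowerSeries.mk fun n =>
    ∑ k ∈ Finset.range (n + 1), if n = Fintype.card F ^ k then bigL F s G k else 0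

/-- The Carlitz exponential `exp_C(f) = ∑_{j ≥ 0} f ^ {q^j} / D_j` on power series in `Z` without
constant term. By `coeff_pow_eq_zero`, terms with `j > n` do not contribute to the
coefficient of `Z ^ n`. -/
def expC (s : ℕ) (f : PowerSeries (KPoly F s)) : PowerSeries (KPoly F s) :=
  PowerSeries.mk fun n =>
    ∑ j ∈ Finset.range (n + 1),
      invC F s (carlitzD F j) * PowerSeries.coeff n (f ^ Fintype.card F ^ j)

theorem coeff_pow_eq_zero (s : ℕ) (f : PowerSeries (KPoly F s))
    (hf : PowerSeries.constantCoeff f = 0) {n j : ℕ} (h : n < j) :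
    PowerSeries.coeff n (f ^ Fintype.card F ^ j) = 0 := by
  have h1 : (PowerSeries.X : PowerSeries (KPoly F s)) ∣ f := PowerSeries.X_dvd_iff.2 hf
  have h2 := pow_dvd_pow_of_dvd h1 (Fintype.card F ^ j)
  exact PowerSeries.X_pow_dvd_iff.1 h2 n (h.trans (Nat.lt_pow_self Fintype.one_lt_card))

theorem constantCoeff_littleL (s : ℕ) (G : KPoly F s) :
    PowerSeries.constantCoeff (littleL F s G) = 0 := by
  rw [← PowerSeries.coeff_zero_eq_constantCoeff_apply, littleL, PowerSeries.coeff_mk]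
  simp

/-- `𝕊_s(X_1, …, X_s, Z) = exp_C(l(X_1 ⋯ X_s, Z))`, as an element of `K[X_1, …, X_s][[Z]]`. -/
def specialS (s : ℕ) : PowerSeries (KPoly F s) :=
  expC F s (littleL F s (∏ i, MvPolynomial.X i))

/-- `L(1, s, z) = ∑_{d ≥ 0} z^d ∑_{a ∈ A_{+,d}} a(t_1) ⋯ a(t_s) / a` in `K[t_1, …, t_s][[z]]`. -/
def lSeries (s : ℕ) : PowerSeries (KPoly F s) :=
  PowerSeries.mk fun d => ∑ a ∈ monics F d,
    invC F s a * ∏ i, Polynomial.aeval (MvPolynomial.X i : KPoly F s) a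

/-- The operator `φ` on `K[t_1, …, t_s][[z]]`: raise the coefficients in `K` to the power `q`. -/
def phi (s : ℕ) : PowerSeries (KPoly F s) →+* PowerSeries (KPoly F s) :=
  PowerSeries.map (MvPolynomial.map
    (FiniteField.frobeniusAlgHom F (RatFunc F) : RatFunc F →+* RatFunc F))

/-- `τ_z(f) = z (t_1 - θ) ⋯ (t_s - θ) φ(f)`. -/
def tauZ (s : ℕ) (f : PowerSeries (KPoly F s)) : PowerSeries (KPoly F s) :=
  PowerSeries.X * PowerSeries.C (∏ i, (MvPolynomial.X i - MvPolynomial.C RatFunc.X)) * phi F s f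

/-- `exp_z(f) = ∑_{j ≥ 0} τ_z^j(f) / D_j`. By `coeff_tauZ_iterate_eq_zero`, terms with `j > n`
do not contribute to the coefficient of `z ^ n`. -/
def expZ (s : ℕ) (f : PowerSeries (KPoly F s)) : PowerSeries (KPoly F s) :=
  PowerSeries.mk fun n =>
    ∑ j ∈ Finset.range (n + 1),
      invC F s (carlitzD F j) * PowerSeries.coeff n ((tauZ F s)^[j] f)

theorem coeff_tauZ_iterate_eq_zero (s : ℕ) (f : PowerSeries (KPoly F s)) {n j : ℕ} (h : n < j) :
    PowerSeries.coeff n ((tauZ F s)^[j] f) = 0 := by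
  induction j generalizing n with
  | zero => omega
  | succ j ih =>
    rw [Function.iterate_succ_apply', tauZ, mul_assoc]
    cases n with
    | zero => simp
    | succ n =>
      rw [PowerSeries.coeff_succ_X_mul, PowerSeries.coeff_C_mul, phi, PowerSeries.coeff_map,
        ih (by omega), map_zero, mul_zero]

/-- `σ_s = exp_z(L(1, s, z))`, as an element of `K[t_1, …, t_s][[z]]`. -/
def sigma (s : ℕ) : PowerSeries (KPoly F s) := expZ F s (lSeries F s)

end AndersonStark

end

/-! Write `τ` for the coefficient operator `(t_1 - θ) ⋯ (t_s - θ) φ`, so that `τ_z = z τ`. The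
recursion for `D_j` gives `exp_z(θ f) = (θ + τ_z) exp_z(f)` (`expZ_theta_mul`), so `exp_z` turns
multiplication by `a` into the Carlitz operator `C_a(τ_z)`.

Integrality is checked at each monic prime `P` of degree `d`. The operator `C_P(τ_z) - z^d P(t_1) ⋯
P(t_s)` strips the Euler factor at `P` from the series inside `exp_z`, and the result is divisible
by `P` because `v_P(D_j) < q^j`. On `P`-integral series the operator itself vanishes mod `P`.
Induction on the coefficients of `z` then makes `σ_s` integral at `P` (`coeffLe_sigma`).

At the infinite place, the coefficient of `z^n` has degree at most `-n` in `θ` as soon as `n (q - 1)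
≥ s`. Being integral, it vanishes when `n > 0` (`coeff_sigma_eq_zero`). This gives polynomiality and
the degree bound.

The `K`-linear map `t^m ↦ ∏ C_{θ^{m_k}}(X_k)` turns `τ` into the `q`-th power, so it carries the
`z^n`-coefficient of `σ_s` to the `Z^{q^n}`-coefficient of `𝕊_s` (`specialS_eq`). It is injective by
triangularity, whence `𝕊_s(1) = 0` iff `σ_s(1) = 0`.

Finally `σ_s(1)` is evaluated at the Zariski-dense points `t_k = θ^{q^{m_k}}`. There it becomes a
finite combination of power sums of monic polynomials. If `s > 1` and `s ≡ 1` mod `q - 1`, all of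
them are trivial zeros of the Carlitz-Goss zeta function. Otherwise the point `t_k = θ` already
gives a nonzero value. -/

noncomputable section

namespace AndersonStark

variable {F : Type*} [Field F] {s : ℕ}

local notation "q" => Fintype.card F

/-! ### The operators `τ_z` and `exp_z` -/

section Operators

variable [Fintype F]

/-- The inclusion of constants `A → K[Y_1, …, Y_s]`. -/
def constA (F : Type*) [Field F] [Fintype F] (s : ℕ) : F[X] →+* KPoly F s :=
  MvPolynomial.C.comp (algebraMap F[X] (RatFunc F))

/-- The additive map `τ(r) = (t_1 - θ) ⋯ (t_s - θ) φ(r)` on `K[t_1, …, t_s]`. -/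
def tau (F : Type*) [Field F] [Fintype F] (s : ℕ) : KPoly F s →+ KPoly F s :=
  (AddMonoidHom.mulLeft
    (∏ i, (MvPolynomial.X i - MvPolynomial.C RatFunc.X))).comp
    (MvPolynomial.map
      (FiniteField.frobeniusAlgHom F (RatFunc F) : RatFunc F →+* RatFunc F)).toAddMonoidHom

theorem tau_apply (r : KPoly F s) :
    tau F s r = (∏ i, (MvPolynomial.X i - MvPolynomial.C RatFunc.X)) *
      MvPolynomial.map (FiniteField.frobeniusAlgHom F (RatFunc F) : RatFunc F →+* RatFunc F) r :=
  rfl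

theorem tau_C_mul (c : RatFunc F) (r : KPoly F s) :
    tau F s (MvPolynomial.C c * r) = MvPolynomial.C (c ^ q) * tau F s r := by
  simp only [tau_apply, map_mul, MvPolynomial.map_C]
  simp only [RingHom.coe_coe, FiniteField.frobeniusAlgHom_apply]
  ring

theorem iterate_tau_C_mul (j : ℕ) (c : RatFunc F) (r : KPoly F s) :
    (tau F s)^[j] (MvPolynomial.C c * r) = MvPolynomial.C (c ^ q ^ j) * (tau F s)^[j] r := by
  induction j with
  | zero => simp
  | succ j ih =>
    rw [Function.iterate_succ_apply', Function.iterate_succ_apply', ih, tau_C_mul, ← pow_mul,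
      pow_succ]

theorem tau_map_mul (g : MvPolynomial (Fin s) F) (r : KPoly F s) :
    tau F s (MvPolynomial.map (algebraMap F (RatFunc F)) g * r) =
      MvPolynomial.map (algebraMap F (RatFunc F)) g * tau F s r := by
  have h : (FiniteField.frobeniusAlgHom F (RatFunc F) : RatFunc F →+* RatFunc F).comp
      (algebraMap F (RatFunc F)) = algebraMap F (RatFunc F) := by
    ext x
    simp [← map_pow, FiniteField.pow_card]
  rw [tau_apply, tau_apply, map_mul, MvPolynomial.map_map, h]
  ring

theorem iterate_tau_map_mul (j : ℕ) (g : MvPolynomial (Fin s) F) (r : KPoly F s) :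
    (tau F s)^[j] (MvPolynomial.map (algebraMap F (RatFunc F)) g * r) =
      MvPolynomial.map (algebraMap F (RatFunc F)) g * (tau F s)^[j] r := by
  induction j with
  | zero => rfl
  | succ j ih => rw [Function.iterate_succ_apply', Function.iterate_succ_apply', ih, tau_map_mul]

theorem coeff_zero_tauZ (f : PowerSeries (KPoly F s)) :
    PowerSeries.coeff 0 (tauZ F s f) = 0 := by
  rw [tauZ, mul_assoc]
  simp

theorem coeff_succ_tauZ (f : PowerSeries (KPoly F s)) (n : ℕ) :
    PowerSeries.coeff (n + 1) (tauZ F s f) = tau F s (PowerSeries.coeff n f) := by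
  rw [tauZ, mul_assoc, PowerSeries.coeff_succ_X_mul, PowerSeries.coeff_C_mul, phi,
    PowerSeries.coeff_map, tau_apply]

theorem coeff_add_iterate_tauZ (f : PowerSeries (KPoly F s)) (j m : ℕ) :
    PowerSeries.coeff (j + m) ((tauZ F s)^[j] f) = (tau F s)^[j] (PowerSeries.coeff m f) := by
  induction j with
  | zero => simp
  | succ j ih =>
    rw [add_right_comm, Function.iterate_succ_apply', coeff_succ_tauZ, ih,
      Function.iterate_succ_apply']

theorem coeff_expZ (f : PowerSeries (KPoly F s)) (n : ℕ) :
    PowerSeries.coeff n (expZ F s f) = ∑ p ∈ Finset.HasAntidiagonal.antidiagonal n,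
      invC F s (carlitzD F p.1) * (tau F s)^[p.1] (PowerSeries.coeff p.2 f) := by
  rw [expZ, PowerSeries.coeff_mk, Finset.Nat.sum_antidiagonal_eq_sum_range_succ_mk]
  refine Finset.sum_congr rfl fun j hj => ?_
  have hj : j ≤ n := by simpa [Nat.lt_succ_iff] using hj
  obtain ⟨m, rfl⟩ := Nat.exists_eq_add_of_le hj
  rw [coeff_add_iterate_tauZ]
  simp

theorem expZ_add (f g : PowerSeries (KPoly F s)) :
    expZ F s (f + g) = expZ F s f + expZ F s g := by
  ext1 n
  simp only [map_add, coeff_expZ, iterate_map_add, mul_add, Finset.sum_add_distrib]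

/-- `exp_z` as an additive map. -/
def expZHom (F : Type*) [Field F] [Fintype F] (s : ℕ) :
    PowerSeries (KPoly F s) →+ PowerSeries (KPoly F s) :=
  AddMonoidHom.mk' (expZ F s) expZ_add

theorem expZ_C_map_mul (g : MvPolynomial (Fin s) F) (f : PowerSeries (KPoly F s)) :
    expZ F s (PowerSeries.C (MvPolynomial.map (algebraMap F (RatFunc F)) g) * f) =
      PowerSeries.C (MvPolynomial.map (algebraMap F (RatFunc F)) g) * expZ F s f := by
  ext1 n
  simp only [coeff_expZ, PowerSeries.coeff_C_mul, iterate_tau_map_mul, Finset.mul_sum]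
  exact Finset.sum_congr rfl fun _ _ => mul_left_comm _ _ _

theorem expZ_X_mul (f : PowerSeries (KPoly F s)) :
    expZ F s (PowerSeries.X * f) = PowerSeries.X * expZ F s f := by
  ext1 n
  cases n with
  | zero =>
    rw [coeff_expZ]
    simp
  | succ n =>
    rw [PowerSeries.coeff_succ_X_mul, coeff_expZ, coeff_expZ,
      Finset.Nat.sum_antidiagonal_succ']
    simp [PowerSeries.coeff_succ_X_mul]

theorem expZ_X_pow_mul (d : ℕ) (f : PowerSeries (KPoly F s)) :
    expZ F s (PowerSeries.X ^ d * f) = PowerSeries.X ^ d * expZ F s f := by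
  induction d with
  | zero => simp
  | succ d ih => rw [pow_succ', mul_assoc, expZ_X_mul, ih, mul_assoc]

theorem X_pow_card_pow_sub_X_ne_zero (i : ℕ) :
    (X ^ q ^ (i + 1) - X : F[X]) ≠ 0 :=
  FiniteField.X_pow_card_sub_X_ne_zero F (Nat.one_lt_pow (by omega) Fintype.one_lt_card)

theorem carlitzD_ne_zero (j : ℕ) : carlitzD F j ≠ 0 := by
  induction j with
  | zero => exact one_ne_zero
  | succ j ih => exact mul_ne_zero (X_pow_card_pow_sub_X_ne_zero j) (pow_ne_zero _ ih)

/-- The operator `θ + τ_z`, through which `θ` acts on the values of `exp_z`. -/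
def thetaTau (F : Type*) [Field F] [Fintype F] (s : ℕ) :
    AddMonoid.End (PowerSeries (KPoly F s)) :=
  AddMonoidHom.mk' (fun f => PowerSeries.C (MvPolynomial.C RatFunc.X) * f + tauZ F s f)
    fun f g => by
      ext1 n
      cases n <;>
      simp only [map_add, mul_add, coeff_zero_tauZ, coeff_succ_tauZ] <;> abel

theorem thetaTau_apply (f : PowerSeries (KPoly F s)) :
    thetaTau F s f = PowerSeries.C (MvPolynomial.C RatFunc.X) * f + tauZ F s f :=
  rfl

/-- The recursion for `D` is equivalent to `θ^{q^{j+1}} / D_{j+1} = θ / D_{j+1} + 1 / D_j^q`; the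
last term is what `τ_z` produces from the `j`-th summand. -/
theorem expZ_theta_mul (f : PowerSeries (KPoly F s)) :
    expZ F s (PowerSeries.C (MvPolynomial.C RatFunc.X) * f) = thetaTau F s (expZ F s f) := by
  ext1 n
  rw [thetaTau_apply, map_add, PowerSeries.coeff_C_mul]
  cases n with
  | zero =>
    rw [coeff_zero_tauZ, coeff_expZ, coeff_expZ]
    simp [carlitzD, invC]
  | succ n =>
    rw [coeff_succ_tauZ, coeff_expZ, coeff_expZ, coeff_expZ, Finset.Nat.sum_antidiagonal_succ,
      Finset.Nat.sum_antidiagonal_succ, map_sum, mul_add, add_assoc, Finset.mul_sum,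
      ← Finset.sum_add_distrib]
    congr 1
    · simp [carlitzD, invC]
    · refine Finset.sum_congr rfl fun p _ => ?_
      dsimp only
      rw [PowerSeries.coeff_C_mul, iterate_tau_C_mul, invC, invC, tau_C_mul,
        ← Function.iterate_succ_apply' (tau F s), Nat.succ_eq_add_one, ← mul_assoc,
        ← mul_assoc, ← add_mul, ← map_mul, ← map_mul, ← map_add]
      congr 2
      have h1 := (map_ne_zero_iff (algebraMap F[X] (RatFunc F))
        (IsFractionRing.injective _ _)).2 (X_pow_card_pow_sub_X_ne_zero (F := F) p.1)
      have h2 := (map_ne_zero_iff (algebraMap F[X] (RatFunc F))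
        (IsFractionRing.injective _ _)).2 (carlitzD_ne_zero (F := F) p.1)
      have h3 := pow_ne_zero q h2
      rw [carlitzD]
      simp only [map_mul, map_sub, map_pow, RatFunc.algebraMap_X, inv_pow] at h1 ⊢
      field_simp
      ring

theorem constA_apply (a : F[X]) :
    constA F s a = MvPolynomial.C (algebraMap F[X] (RatFunc F) a) :=
  rfl

theorem expZ_theta_pow_mul (n : ℕ) (f : PowerSeries (KPoly F s)) :
    expZ F s (PowerSeries.C (MvPolynomial.C RatFunc.X) ^ n * f) =
      (thetaTau F s ^ n) (expZ F s f) := by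
  induction n with
  | zero => simp
  | succ n ih =>
    rw [pow_succ', mul_assoc, expZ_theta_mul, ih, pow_succ']
    rfl

/-- Evaluation of a polynomial over `A` at `θ + τ_z`, the coefficients written on the left. -/
def leftEval (F : Type*) [Field F] [Fintype F] (s : ℕ) (p : F[X][X]) :
    AddMonoid.End (PowerSeries (KPoly F s)) :=
  p.eval₂ ((Module.toAddMonoidEnd (PowerSeries (KPoly F s)) (PowerSeries (KPoly F s))).comp
    (PowerSeries.C.comp (constA F s))) (thetaTau F s)

theorem leftEval_sub (p r : F[X][X]) (f : PowerSeries (KPoly F s)) :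
    leftEval F s (p - r) f = leftEval F s p f - leftEval F s r f := by
  rw [leftEval, eval₂_sub]
  rfl

theorem leftEval_apply (p : F[X][X]) (f : PowerSeries (KPoly F s)) :
    leftEval F s p f =
      p.sum fun i c => PowerSeries.C (constA F s c) * (thetaTau F s ^ i) f := by
  rw [leftEval, eval₂_eq_sum, Polynomial.sum, Polynomial.sum]
  exact map_sum (AddMonoidHom.eval f) _ _

/-- `θ + τ_z` does not commute with `θ`, so `leftEval` is not multiplicative in general; only a
factor `X` on the right and a scalar on the left are compatible with it. -/
theorem leftEval_mul_X (p : F[X][X]) (f : PowerSeries (KPoly F s)) :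
    leftEval F s (p * X) f = leftEval F s p (thetaTau F s f) := by
  rw [leftEval, eval₂_mul_X]
  rfl

theorem leftEval_smul (a : F[X]) (p : F[X][X]) (f : PowerSeries (KPoly F s)) :
    leftEval F s (a • p) f = PowerSeries.C (constA F s a) * leftEval F s p f := by
  rw [leftEval, eval₂_smul]
  rfl

/-- The coefficients of `a` lie in `F` and commute with `τ_z`, so the relation for `θ` propagates to
all of `A`: the right side is `C_a(τ_z)`. -/
theorem expZ_constA_mul (a : F[X]) (f : PowerSeries (KPoly F s)) :
    expZ F s (PowerSeries.C (constA F s a) * f) = leftEval F s (a.map C) (expZ F s f) := by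
  induction a using Polynomial.induction_on' with
  | add a b ha hb =>
    rw [Polynomial.map_add, leftEval, eval₂_add, map_add, map_add, add_mul, expZ_add, ha, hb]
    rfl
  | monomial n c =>
    have hc : constA F s (C c) =
        MvPolynomial.map (algebraMap F (RatFunc F)) (MvPolynomial.C c) := by
      rw [MvPolynomial.map_C, constA_apply, RatFunc.algebraMap_C]
      rfl
    have hX : constA F s X = MvPolynomial.C RatFunc.X := by
      rw [constA_apply, RatFunc.algebraMap_X]
    rw [map_monomial, leftEval_apply, sum_monomial_index _ _ (by rw [map_zero, map_zero, zero_mul]),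
      ← C_mul_X_pow_eq_monomial, map_mul, hc, map_pow, hX, map_mul, map_pow, mul_assoc,
      expZ_C_map_mul, expZ_theta_pow_mul]

theorem tauZ_C_C_mul (c : RatFunc F) (f : PowerSeries (KPoly F s)) :
    tauZ F s (PowerSeries.C (MvPolynomial.C c) * f) =
      PowerSeries.C (MvPolynomial.C (c ^ q)) * tauZ F s f := by
  ext1 n
  cases n <;>
  simp only [PowerSeries.coeff_C_mul, coeff_zero_tauZ, coeff_succ_tauZ, tau_C_mul, mul_zero]

theorem iterate_tauZ_C_C_mul (j : ℕ) (c : RatFunc F) (f : PowerSeries (KPoly F s)) :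
    (tauZ F s)^[j] (PowerSeries.C (MvPolynomial.C c) * f) =
      PowerSeries.C (MvPolynomial.C (c ^ q ^ j)) * (tauZ F s)^[j] f := by
  induction j with
  | zero => simp
  | succ j ih =>
    rw [Function.iterate_succ_apply', Function.iterate_succ_apply', ih, tauZ_C_C_mul, ← pow_mul,
      pow_succ]

theorem iterate_tauZ_sub (j : ℕ) (f g : PowerSeries (KPoly F s)) :
    (tauZ F s)^[j] (f - g) = (tauZ F s)^[j] f - (tauZ F s)^[j] g := by
  induction j with
  | zero => rfl
  | succ j ih =>
    rw [Function.iterate_succ_apply', ih, Function.iterate_succ_apply', Function.iterate_succ_apply']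
    ext1 n
    cases n <;> simp only [map_sub, coeff_zero_tauZ, coeff_succ_tauZ, sub_zero]

/-- `b_j(t) = ∏_{l < j} (t - θ^{q^l})`, a polynomial in `t` over `A`. -/
def bPoly (F : Type*) [Field F] [Fintype F] (j : ℕ) : F[X][X] :=
  ∏ l ∈ Finset.range j, (X - C (X ^ Fintype.card F ^ l))

/-- From `τ_z^j θ = θ^{q^j} τ_z^j` one gets `τ_z^{j+1} = τ_z^j (θ + τ_z) - θ^{q^j} τ_z^j`, the
recursion satisfied by `b_j`. -/
theorem iterate_tauZ_eq_leftEval (j : ℕ) (f : PowerSeries (KPoly F s)) :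
    (tauZ F s)^[j] f = leftEval F s (bPoly F j) f := by
  induction j generalizing f with
  | zero => simp [bPoly, leftEval]
  | succ j ih =>
    have h : tauZ F s f =
        thetaTau F s f - PowerSeries.C (MvPolynomial.C RatFunc.X) * f := by
      rw [thetaTau_apply, add_sub_cancel_left]
    have hb : bPoly F (j + 1) = bPoly F j * X - (X ^ q ^ j : F[X]) • bPoly F j := by
      rw [bPoly, Finset.prod_range_succ, mul_sub, smul_eq_C_mul, mul_comm (C _)]
      rfl
    rw [Function.iterate_succ_apply, h, iterate_tauZ_sub, iterate_tauZ_C_C_mul, ih, ih, hb,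
      leftEval_sub, leftEval_mul_X, leftEval_smul, constA_apply,
      map_pow (algebraMap F[X] (RatFunc F)), RatFunc.algebraMap_X]

theorem eval₂_bPoly (j : ℕ) (r : KPoly F s) :
    (bPoly F j).eval₂ (constA F s) r =
      ∏ l ∈ Finset.range j, (r - MvPolynomial.C (RatFunc.X ^ q ^ l)) := by
  rw [bPoly, eval₂_finsetProd]
  refine Finset.prod_congr rfl fun l _ => ?_
  rw [eval₂_sub, eval₂_X, eval₂_C, constA_apply, map_pow, RatFunc.algebraMap_X]

theorem iterate_tau_eq (j : ℕ) (r : KPoly F s) :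
    (tau F s)^[j] r = (∏ k, (bPoly F j).eval₂ (constA F s) (MvPolynomial.X k)) *
      (MvPolynomial.map (FiniteField.frobeniusAlgHom F (RatFunc F) :
        RatFunc F →+* RatFunc F))^[j] r := by
  induction j with
  | zero => simp [eval₂_bPoly]
  | succ j ih =>
    rw [Function.iterate_succ_apply', ih, tau_apply, map_mul, map_prod, ← mul_assoc,
      ← Finset.prod_mul_distrib, Function.iterate_succ_apply']
    congr 1
    refine Finset.prod_congr rfl fun k _ => ?_
    rw [eval₂_bPoly, eval₂_bPoly, Finset.prod_range_succ', map_prod, mul_comm]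
    simp only [map_sub, MvPolynomial.map_X, MvPolynomial.map_C, RingHom.coe_coe,
      FiniteField.frobeniusAlgHom_apply, ← pow_mul, pow_succ, pow_zero, pow_one]

end Operators

/-! ### Gauss valuations and arithmetic at a prime of `A` -/

section Valuations

section CoeffLe

variable {Γ : Type*} [LinearOrderedCommGroupWithZero Γ] {v : Valuation (RatFunc F) Γ}
  {γ δ : Γ} {f g : KPoly F s}

/-- All coefficients of `f` have valuation at most `γ`. -/
def CoeffLe (v : Valuation (RatFunc F) Γ) (γ : Γ) (f : KPoly F s) : Prop :=
  ∀ m, v (f.coeff m) ≤ γ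

theorem CoeffLe.mono (hf : CoeffLe v γ f) (h : γ ≤ δ) : CoeffLe v δ f :=
  fun m => (hf m).trans h

theorem coeffLe_zero : CoeffLe v γ (0 : KPoly F s) := fun m => by simp

theorem CoeffLe.add (hf : CoeffLe v γ f) (hg : CoeffLe v γ g) : CoeffLe v γ (f + g) :=
  fun m => by rw [MvPolynomial.coeff_add]; exact v.map_add_le (hf m) (hg m)

theorem CoeffLe.sub (hf : CoeffLe v γ f) (hg : CoeffLe v γ g) : CoeffLe v γ (f - g) :=
  fun m => by rw [MvPolynomial.coeff_sub]; exact v.map_sub_le (hf m) (hg m)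

theorem CoeffLe.sum {ι : Type*} {t : Finset ι} {f : ι → KPoly F s}
    (h : ∀ i ∈ t, CoeffLe v γ (f i)) : CoeffLe v γ (∑ i ∈ t, f i) :=
  fun m => by rw [MvPolynomial.coeff_sum]; exact v.map_sum_le fun i hi => h i hi m

theorem CoeffLe.mul (hf : CoeffLe v γ f) (hg : CoeffLe v δ g) : CoeffLe v (γ * δ) (f * g) :=
  fun m => by
    classical
    rw [MvPolynomial.coeff_mul]
    refine v.map_sum_le fun p _ => ?_
    rw [map_mul]
    exact mul_le_mul' (hf _) (hg _)

theorem coeffLe_C {c : RatFunc F} (h : v c ≤ γ) :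
    CoeffLe v γ (MvPolynomial.C c : KPoly F s) := fun m => by
  classical
  rw [MvPolynomial.coeff_C]
  split_ifs
  · exact h
  · simp

theorem coeffLe_one : CoeffLe v 1 (1 : KPoly F s) := by
  rw [← MvPolynomial.C_1]
  exact coeffLe_C (by simp)

theorem coeffLe_X (i : Fin s) : CoeffLe v 1 (MvPolynomial.X i : KPoly F s) := fun m => by
  classical
  rw [MvPolynomial.coeff_X]
  split_ifs <;> simp

theorem CoeffLe.prod {ι : Type*} {t : Finset ι} {f : ι → KPoly F s} {γ : ι → Γ}
    (h : ∀ i ∈ t, CoeffLe v (γ i) (f i)) : CoeffLe v (∏ i ∈ t, γ i) (∏ i ∈ t, f i) := by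
  classical
  induction t using Finset.induction_on with
  | empty => simpa using coeffLe_one
  | insert i t hi ih =>
    rw [Finset.prod_insert hi, Finset.prod_insert hi]
    exact (h i (Finset.mem_insert_self _ _)).mul
      (ih fun j hj => h j (Finset.mem_insert_of_mem hj))

theorem CoeffLe.aeval (h : ∀ c : F, v (algebraMap F (RatFunc F) c) ≤ 1) (a : F[X]) (i : Fin s) :
    CoeffLe v 1 (Polynomial.aeval (MvPolynomial.X i : KPoly F s) a) := by
  rw [aeval_eq_sum_range]
  refine CoeffLe.sum fun j _ => ?_
  rw [Algebra.smul_def, MvPolynomial.algebraMap_apply, ← mul_one (1 : Γ)]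
  refine (coeffLe_C (h _)).mul ?_
  have := CoeffLe.prod (v := v) (t := Finset.range j) (γ := fun _ => 1)
    fun _ _ => coeffLe_X (F := F) i
  simpa using this

variable [Fintype F]

theorem CoeffLe.map_frobenius (hf : CoeffLe v γ f) :
    CoeffLe v (γ ^ q) (MvPolynomial.map
      (FiniteField.frobeniusAlgHom F (RatFunc F) : RatFunc F →+* RatFunc F) f) := fun m => by
  rw [MvPolynomial.coeff_map, RingHom.coe_coe, FiniteField.frobeniusAlgHom_apply, map_pow]
  exact pow_le_pow_left' (hf m) _

theorem CoeffLe.tau (hθ : v RatFunc.X ≤ δ) (hδ : 1 ≤ δ) (hf : CoeffLe v γ f) :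
    CoeffLe v (δ ^ s * γ ^ q) (tau F s f) := by
  rw [tau_apply]
  refine CoeffLe.mul ?_ hf.map_frobenius
  have := CoeffLe.prod (v := v) (t := (Finset.univ : Finset (Fin s))) (γ := fun _ => δ)
    (f := fun i => MvPolynomial.X i - MvPolynomial.C RatFunc.X)
    fun i _ => ((coeffLe_X i).mono hδ).sub (coeffLe_C hθ)
  simpa using this

end CoeffLe

/-! ### Reduction of `b_d` modulo `P`, and the order of `D_j` at `P`. -/

section Prime

variable {P : F[X]}

theorem finrank_adjoinRoot (hP : Irreducible P) :
    Module.finrank F (AdjoinRoot P) = P.natDegree := by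
  rw [(AdjoinRoot.powerBasis hP.ne_zero).finrank, AdjoinRoot.powerBasis_dim]

variable [Fintype F]

theorem dvd_pow_card_pow_natDegree_sub (hP : Irreducible P) (a : F[X]) :
    P ∣ a ^ q ^ P.natDegree - a := by
  have := Fact.mk hP
  have : Module.Finite F (AdjoinRoot P) := (AdjoinRoot.powerBasis hP.ne_zero).finite
  have : Finite (AdjoinRoot P) := Module.finite_of_finite F
  have := Fintype.ofFinite (AdjoinRoot P)
  rw [← AdjoinRoot.mk_eq_mk, map_pow, ← finrank_adjoinRoot hP, ← Module.card_eq_pow_finrank,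
    FiniteField.pow_card]

/-- Over the field `A/P` the roots of `P` are the Frobenius conjugates of the class of `θ`, and
`b_d` is the product over these conjugates. -/
theorem map_mk_bPoly (hP : Irreducible P) (hm : P.Monic) :
    (bPoly F P.natDegree).map (AdjoinRoot.mk P) = P.map (AdjoinRoot.of P) := by
  have := Fact.mk hP
  have : Module.Finite F (AdjoinRoot P) := (AdjoinRoot.powerBasis hP.ne_zero).finite
  have : Finite (AdjoinRoot P) := Module.finite_of_finite F
  have h0 : (bPoly F P.natDegree).map (AdjoinRoot.mk P) =
      ∏ l ∈ Finset.range P.natDegree, (X - C (AdjoinRoot.root P ^ q ^ l)) := by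
    rw [bPoly, Polynomial.map_prod]
    refine Finset.prod_congr rfl fun l _ => ?_
    rw [Polynomial.map_sub, map_X, map_C, map_pow, AdjoinRoot.mk_X]
  have hfrob (l : ℕ) (x : AdjoinRoot P) :
      (FiniteField.frobeniusAlgHom F (AdjoinRoot P) ^ l) x = x ^ q ^ l := by
    rw [AlgHom.coe_pow, FiniteField.coe_frobeniusAlgHom, pow_iterate]
  rw [h0]
  refine (eq_of_monic_of_dvd_of_natDegree_le
    (monic_prod_of_monic _ _ fun l _ => monic_X_sub_C _) (hm.map _) ?_ ?_).symm
  · refine Finset.prod_dvd_of_coprime (fun i hi j hj hij => ?_) fun l _ => ?_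
    -- Two equal conjugates would give two powers of Frobenius agreeing on a generator of `A/P`,
    -- hence equal, with both exponents below the degree.
    · refine isCoprime_X_sub_C_of_isUnit_sub (IsUnit.mk0 _ (sub_ne_zero.2 fun h => hij ?_))
      rw [Finset.mem_coe, Finset.mem_range, ← finrank_adjoinRoot hP] at hi hj
      have h2 := (FiniteField.bijective_frobeniusAlgHom_pow F (AdjoinRoot P)).1
        (a₁ := ⟨i, hi⟩) (a₂ := ⟨j, hj⟩)
        (AdjoinRoot.algHom_ext (by rw [hfrob, hfrob]; exact h))
      exact congrArg Fin.val h2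
    · rw [dvd_iff_isRoot, IsRoot, eval_map, ← hfrob, ← AdjoinRoot.algebraMap_eq, ← aeval_def,
        aeval_algHom_apply, AdjoinRoot.aeval_eq, AdjoinRoot.mk_self, map_zero]
  · rw [hm.natDegree_map, natDegree_prod_of_monic _ _ fun l _ => monic_X_sub_C _]
    simp only [natDegree_X_sub_C, Finset.sum_const, Finset.card_range, smul_eq_mul, mul_one,
      le_refl]

theorem dvd_coeff_bPoly_sub (hP : Irreducible P) (hm : P.Monic) (i : ℕ) :
    P ∣ (bPoly F P.natDegree - P.map C).coeff i := by
  have h := congrArg (coeff · i) (map_mk_bPoly hP hm)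
  simp only [coeff_map] at h
  rw [coeff_sub, coeff_map, ← AdjoinRoot.mk_eq_mk, h]
  rfl

/-- Since `θ^{q^{j+1}} - θ` is squarefree, the order `e_j` of `D_j` at `P` satisfies `e_{j+1} ≤ 1 +
q e_j`, which preserves `e_j ≤ q^j - 1`. -/
theorem exists_carlitzD_eq (hP : Irreducible P) (j : ℕ) :
    ∃ e w, carlitzD F j = P ^ e * w ∧ ¬ P ∣ w ∧ e < q ^ j := by
  induction j with
  | zero =>
    exact ⟨0, 1, by simp [carlitzD], fun h => hP.not_isUnit (isUnit_of_dvd_one h), by simp⟩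
  | succ j ih =>
    obtain ⟨e, w, h, hw, he⟩ := ih
    have hfin : FiniteMultiplicity P (X ^ q ^ (j + 1) - X) :=
      FiniteMultiplicity.of_not_isUnit hP.not_isUnit (X_pow_card_pow_sub_X_ne_zero j)
    obtain ⟨w', h', hw'⟩ := hfin.exists_eq_pow_mul_and_not_dvd
    have hsq : Squarefree (X ^ q ^ (j + 1) - X : F[X]) := by
      obtain ⟨p, hp⟩ := CharP.exists F
      refine (galois_poly_separable p _ ?_).squarefree
      exact dvd_pow ((CharP.cast_eq_zero_iff F p q).1 (FiniteField.cast_card_eq_zero F))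
        (Nat.succ_ne_zero j)
    have hle : multiplicity P (X ^ q ^ (j + 1) - X) ≤ 1 := by
      by_contra hlt
      refine hP.not_isUnit (hsq P ?_)
      rw [← pow_two, h']
      exact (pow_dvd_pow P (by omega)).mul_right _
    refine ⟨multiplicity P (X ^ q ^ (j + 1) - X) + e * q, w' * w ^ q, ?_, ?_, ?_⟩
    · rw [carlitzD, h, mul_pow, ← pow_mul, pow_add P]
      nth_rw 1 [h']
      ring
    · intro hd
      rcases hP.prime.dvd_or_dvd hd with hd | hd
      · exact hw' hd
      · exact hw (hP.prime.dvd_of_dvd_pow hd)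
    · have h1 : (e + 1) * q ≤ q ^ j * q := Nat.mul_le_mul_right _ he
      have h2 : 1 < q := Fintype.one_lt_card
      generalize multiplicity P _ = μ at hle ⊢
      rw [pow_succ]
      linarith

end Prime

section Adic

open IsDedekindDomain

variable (v : HeightOneSpectrum F[X])

theorem exists_monic_generator :
    ∃ P : F[X], Irreducible P ∧ P.Monic ∧ v.asIdeal = Ideal.span {P} := by
  obtain ⟨a, ha⟩ := IsPrincipalIdealRing.principal v.asIdeal
  have ha : v.asIdeal = Ideal.span {a} := ha
  have h0 : a ≠ 0 := by
    rintro rfl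
    exact v.ne_bot (by rw [ha]; simp)
  have hp : Prime a := by
    rw [← Ideal.span_singleton_prime h0, ← ha]
    exact v.isPrime
  have hass : Associated (a * C a.leadingCoeff⁻¹) a := by
    refine associated_mul_unit_left _ _ (isUnit_C.2 ?_)
    simpa using h0
  exact ⟨a * C a.leadingCoeff⁻¹, hass.symm.irreducible hp.irreducible,
    monic_mul_leadingCoeff_inv h0, by rw [ha, Ideal.span_singleton_eq_span_singleton.2 hass]⟩

variable {v} {P : F[X]}

theorem valuation_le_of_dvd {a : F[X]} (h : P ∣ a) :
    v.valuation (RatFunc F) (algebraMap F[X] (RatFunc F) a) ≤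
      v.valuation (RatFunc F) (algebraMap F[X] (RatFunc F) P) := by
  obtain ⟨b, rfl⟩ := h
  rw [map_mul, map_mul]
  exact mul_le_of_le_one_right' (v.valuation_le_one b)

theorem valuation_eq_one_of_not_dvd (hv : v.asIdeal = Ideal.span {P}) {a : F[X]} (h : ¬ P ∣ a) :
    v.valuation (RatFunc F) (algebraMap F[X] (RatFunc F) a) = 1 := by
  rw [v.valuation_eq_one_iff_notMem, hv, Ideal.mem_span_singleton]
  exact h

variable [Fintype F]

/-- For `x = a / b` with `P ∤ b`, the difference has numerator `(a^Q - a) b - a (b^Q - b)`, and the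
congruence in `A` applies to `a` and `b`. -/
theorem valuation_pow_sub_le (hv : v.asIdeal = Ideal.span {P}) (hP : Irreducible P)
    {x : RatFunc F} (hx : v.valuation (RatFunc F) x ≤ 1) :
    v.valuation (RatFunc F) (x ^ q ^ P.natDegree - x) ≤
      v.valuation (RatFunc F) (algebraMap F[X] (RatFunc F) P) := by
  have hxv : x ∈ (v.valuation (RatFunc F)).valuationSubring := hx
  rw [← HeightOneSpectrum.valuationSubringAtPrime_eq_valuationSubring] at hxv
  obtain ⟨a, b, hb, rfl⟩ := hxv
  have hb' : ¬ P ∣ b := by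
    rw [← Ideal.mem_span_singleton, ← hv]
    exact hb
  have hb0 : b ≠ 0 := by
    rintro rfl
    exact hb' (dvd_zero P)
  have hb1 : algebraMap F[X] (RatFunc F) b ≠ 0 :=
    (map_ne_zero_iff _ (IsFractionRing.injective _ _)).2 hb0
  set Q := q ^ P.natDegree
  have key : (algebraMap F[X] (RatFunc F) a * (algebraMap F[X] (RatFunc F) b)⁻¹) ^ Q -
      algebraMap F[X] (RatFunc F) a * (algebraMap F[X] (RatFunc F) b)⁻¹ =
      algebraMap F[X] (RatFunc F) ((a ^ Q - a) * b - a * (b ^ Q - b)) *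
        (algebraMap F[X] (RatFunc F) (b ^ Q * b))⁻¹ := by
    simp only [map_mul, map_sub, map_pow]
    have := pow_ne_zero Q hb1
    rw [mul_pow, inv_pow]
    field_simp
    ring
  rw [key, map_mul, map_inv₀, valuation_eq_one_of_not_dvd hv (a := b ^ Q * b), inv_one, mul_one]
  · refine valuation_le_of_dvd (dvd_sub ?_ ?_)
    · exact (dvd_pow_card_pow_natDegree_sub hP a).mul_right _
    · exact (dvd_pow_card_pow_natDegree_sub hP b).mul_left _
  · intro h
    rcases hP.prime.dvd_or_dvd h with h | h
    · exact hb' (hP.prime.dvd_of_dvd_pow h)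
    · exact hb' h

theorem valuation_inv_carlitzD_mul_le (hv : v.asIdeal = Ideal.span {P}) (hP : Irreducible P)
    (j : ℕ) :
    v.valuation (RatFunc F) ((algebraMap F[X] (RatFunc F) (carlitzD F j))⁻¹ *
      algebraMap F[X] (RatFunc F) P ^ q ^ j) ≤
      v.valuation (RatFunc F) (algebraMap F[X] (RatFunc F) P) := by
  obtain ⟨e, w, h, hw, he⟩ := exists_carlitzD_eq hP j
  obtain ⟨k, hk⟩ := Nat.exists_eq_add_of_lt he
  have hP0 : algebraMap F[X] (RatFunc F) P ≠ 0 :=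
    (map_ne_zero_iff _ (IsFractionRing.injective _ _)).2 hP.ne_zero
  have key : (algebraMap F[X] (RatFunc F) (carlitzD F j))⁻¹ *
      algebraMap F[X] (RatFunc F) P ^ q ^ j =
      (algebraMap F[X] (RatFunc F) w)⁻¹ * algebraMap F[X] (RatFunc F) (P ^ (k + 1)) := by
    rw [h, hk, map_mul, map_pow, mul_inv, add_assoc, pow_add, map_pow]
    have := pow_ne_zero e hP0
    field_simp
  rw [key, map_mul, map_inv₀, valuation_eq_one_of_not_dvd hv hw, inv_one, one_mul]
  exact valuation_le_of_dvd (dvd_pow_self P (Nat.succ_ne_zero k))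

end Adic

end Valuations

/-! ### Integrality of `σ_s` -/

section Integrality

variable [Fintype F]

theorem algebraMap_eq_constA_C (c : F) : algebraMap F (KPoly F s) c = constA F s (C c) := by
  rw [constA_apply, RatFunc.algebraMap_C, MvPolynomial.algebraMap_apply]
  rfl

theorem eval₂_map_C_eq_aeval (a : F[X]) (r : KPoly F s) :
    (a.map C).eval₂ (constA F s) r = aeval r a := by
  rw [eval₂_map, aeval_def]
  exact congrArg (eval₂ · r a) (RingHom.ext fun c => (algebraMap_eq_constA_C c).symm)

/-- The product `a(t_1) ⋯ a(t_s)`. -/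
def prodEval (F : Type*) [Field F] (s : ℕ) (a : F[X]) : KPoly F s :=
  ∏ i, Polynomial.aeval (MvPolynomial.X i : KPoly F s) a

omit [Fintype F] in
theorem prodEval_mul (a b : F[X]) : prodEval F s (a * b) = prodEval F s a * prodEval F s b := by
  simp only [prodEval, map_mul, Finset.prod_mul_distrib]

omit [Fintype F] in
theorem prodEval_eq_map (a : F[X]) : prodEval F s a =
    MvPolynomial.map (algebraMap F (RatFunc F))
      (∏ i, Polynomial.aeval (MvPolynomial.X i : MvPolynomial (Fin s) F) a) := by
  rw [prodEval, map_prod]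
  refine Finset.prod_congr rfl fun i _ => ?_
  rw [aeval_def, aeval_def, hom_eval₂, MvPolynomial.map_X]
  congr 1
  ext1 c
  simp [MvPolynomial.algebraMap_apply]

theorem coeff_lSeries (n : ℕ) : PowerSeries.coeff n (lSeries F s) =
    ∑ a ∈ monics F n, invC F s a * prodEval F s a := by
  rw [lSeries, PowerSeries.coeff_mk]
  rfl

omit [Fintype F] in
theorem invC_mul (a b : F[X]) : invC F s (a * b) = invC F s a * invC F s b := by
  rw [invC, invC, invC, map_mul, mul_inv, map_mul]

theorem constA_mul_invC {a : F[X]} (ha : a ≠ 0) : constA F s a * invC F s a = 1 := by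
  rw [constA_apply, invC, ← map_mul, mul_inv_cancel₀, map_one]
  exact (map_ne_zero_iff _ (IsFractionRing.injective _ _)).2 ha

theorem sum_monics_filter_dvd {M : Type*} [AddCommMonoid M] {P : F[X]} (hm : P.Monic)
    (g : F[X] → M) (n : ℕ) [DecidablePred (P ∣ ·)] :
    ∑ a ∈ monics F n with P ∣ a, g a =
      if P.natDegree ≤ n then ∑ b ∈ monics F (n - P.natDegree), g (P * b) else 0 := by
  split_ifs with h
  · symm
    refine Finset.sum_bij (fun b _ => P * b) (fun b hb => ?_) (fun b _ c _ hbc => ?_)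
      (fun a ha => ?_) fun _ _ => rfl
    · rw [mem_monics] at hb
      rw [Finset.mem_filter, mem_monics]
      refine ⟨⟨hm.mul hb.1, ?_⟩, dvd_mul_right P b⟩
      rw [hm.natDegree_mul hb.1, hb.2]
      omega
    · exact mul_left_cancel₀ hm.ne_zero hbc
    · rw [Finset.mem_filter, mem_monics] at ha
      obtain ⟨⟨ha1, ha2⟩, b, rfl⟩ := ha
      have hb := hm.of_mul_monic_left ha1
      refine ⟨b, ?_, rfl⟩
      rw [mem_monics]
      rw [hm.natDegree_mul hb] at ha2
      exact ⟨hb, by omega⟩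
  · rw [Finset.filter_false_of_mem, Finset.sum_empty]
    rintro a ha ⟨b, rfl⟩
    rw [mem_monics] at ha
    have hb := hm.of_mul_monic_left ha.1
    rw [hm.natDegree_mul hb] at ha
    omega

/-- Removing the Euler factor at `P` from `L(1, s, z)`. -/
theorem coeff_lSeries_sub {P : F[X]} (hm : P.Monic) (n : ℕ) [DecidablePred (P ∣ ·)] :
    PowerSeries.coeff n (lSeries F s -
      PowerSeries.X ^ P.natDegree * (PowerSeries.C (invC F s P * prodEval F s P) * lSeries F s)) =
    ∑ a ∈ monics F n with ¬ P ∣ a, invC F s a * prodEval F s a := by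
  rw [map_sub, PowerSeries.coeff_X_pow_mul', coeff_lSeries, sub_eq_iff_eq_add, add_comm,
    ← Finset.sum_filter_add_sum_filter_not _ (P ∣ ·)]
  congr 1
  rw [sum_monics_filter_dvd hm]
  refine if_congr Iff.rfl ?_ rfl
  rw [PowerSeries.coeff_C_mul, coeff_lSeries, Finset.mul_sum]
  refine Finset.sum_congr rfl fun b _ => ?_
  rw [invC_mul, prodEval_mul]
  ring

/-- The operator `C_P(τ_z) - z^d P(t_1) ⋯ P(t_s)`, where `d` is the degree of `P`. -/
def primeOp (F : Type*) [Field F] [Fintype F] (s : ℕ) (P : F[X])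
    (f : PowerSeries (KPoly F s)) : PowerSeries (KPoly F s) :=
  leftEval F s (P.map C) f - PowerSeries.X ^ P.natDegree * (PowerSeries.C (prodEval F s P) * f)

theorem primeOp_add (P : F[X]) (f g : PowerSeries (KPoly F s)) :
    primeOp F s P (f + g) = primeOp F s P f + primeOp F s P g := by
  rw [primeOp, primeOp, primeOp, map_add]
  ring

/-- `exp_z` commutes with `z` and with `F[t_1, …, t_s]`, so both terms of the operator can be moved
inside; what remains is `P` times the series without its Euler factor at `P`. -/
theorem primeOp_sigma {P : F[X]} (hm : P.Monic) :
    primeOp F s P (sigma F s) = expZ F s (PowerSeries.C (constA F s P) * (lSeries F s -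
      PowerSeries.X ^ P.natDegree *
        (PowerSeries.C (invC F s P * prodEval F s P) * lSeries F s))) := by
  have h : PowerSeries.C (constA F s P) * (lSeries F s - PowerSeries.X ^ P.natDegree *
      (PowerSeries.C (invC F s P * prodEval F s P) * lSeries F s)) =
      PowerSeries.C (constA F s P) * lSeries F s -
      PowerSeries.X ^ P.natDegree * (PowerSeries.C (prodEval F s P) * lSeries F s) := by
    have h1 : (PowerSeries.C (constA F s P) * PowerSeries.C (invC F s P) :
        PowerSeries (KPoly F s)) = 1 := by
      rw [← map_mul, constA_mul_invC hm.ne_zero, map_one]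
    rw [map_mul]
    linear_combination (- PowerSeries.X ^ P.natDegree * (PowerSeries.C (prodEval F s P) *
      lSeries F s)) * h1
  rw [h, ← (show expZHom F s _ = expZ F s _ from rfl), map_sub]
  change _ = expZ F s _ - expZ F s _
  rw [expZ_constA_mul, expZ_X_pow_mul, prodEval_eq_map, expZ_C_map_mul, ← prodEval_eq_map]
  rfl

theorem coeff_thetaTau_pow {h : PowerSeries (KPoly F s)} {n : ℕ}
    (hh : ∀ m < n, PowerSeries.coeff m h = 0) (i : ℕ) :
    (∀ m < n, PowerSeries.coeff m ((thetaTau F s ^ i) h) = 0) ∧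
      PowerSeries.coeff n ((thetaTau F s ^ i) h) =
        MvPolynomial.C RatFunc.X ^ i * PowerSeries.coeff n h := by
  have step (g : PowerSeries (KPoly F s)) (hg : ∀ m < n, PowerSeries.coeff m g = 0) (m : ℕ)
      (hm : m ≤ n) : PowerSeries.coeff m (thetaTau F s g) =
        MvPolynomial.C RatFunc.X * PowerSeries.coeff m g := by
    rw [thetaTau_apply, map_add, PowerSeries.coeff_C_mul]
    cases m with
    | zero => rw [coeff_zero_tauZ, add_zero]
    | succ m => rw [coeff_succ_tauZ, hg m (by omega), map_zero, add_zero]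
  induction i with
  | zero => exact ⟨hh, by simp⟩
  | succ i ih =>
    have hi : (thetaTau F s ^ (i + 1)) h = thetaTau F s ((thetaTau F s ^ i) h) := by
      rw [pow_succ']
      rfl
    rw [hi]
    refine ⟨fun m hm => ?_, ?_⟩
    · rw [step _ ih.1 m hm.le, ih.1 m hm, mul_zero]
    · rw [step _ ih.1 n le_rfl, ih.2, pow_succ', mul_assoc]

/-- `τ_z` and `z^d` raise the order in `z`, so only the constant `P(θ) = P` acts on the lowest
coefficient. -/
theorem coeff_primeOp {P : F[X]} (hd : P.natDegree ≠ 0) {h : PowerSeries (KPoly F s)} {n : ℕ}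
    (hh : ∀ m < n, PowerSeries.coeff m h = 0) :
    PowerSeries.coeff n (primeOp F s P h) = constA F s P * PowerSeries.coeff n h := by
  have h2 : PowerSeries.coeff n
      (PowerSeries.X ^ P.natDegree * (PowerSeries.C (prodEval F s P) * h)) = 0 := by
    rw [PowerSeries.coeff_X_pow_mul']
    split_ifs
    · rw [PowerSeries.coeff_C_mul, hh _ (by omega), mul_zero]
    · rfl
  rw [primeOp, map_sub, h2, sub_zero, leftEval_apply, Polynomial.sum, map_sum]
  have h3 : constA F s P = ∑ i ∈ (P.map C).support,
      constA F s ((P.map C).coeff i) * MvPolynomial.C RatFunc.X ^ i := by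
    have h4 : (P.map C).eval₂ (constA F s) (MvPolynomial.C RatFunc.X) = constA F s P := by
      rw [← RatFunc.algebraMap_X, ← constA_apply, eval₂_map, ← hom_eval₂, eval₂_C_X]
    rw [← h4, eval₂_eq_sum, Polynomial.sum]
  rw [h3, Finset.sum_mul]
  refine Finset.sum_congr rfl fun i _ => ?_
  rw [PowerSeries.coeff_C_mul, (coeff_thetaTau_pow hh i).2, mul_assoc]

section

variable {Γ : Type*} [LinearOrderedCommGroupWithZero Γ] {v : Valuation (RatFunc F) Γ} {γ : Γ}

omit [Fintype F] in
theorem CoeffLe.one_prod {ι : Type*} {t : Finset ι} {f : ι → KPoly F s}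
    (h : ∀ i ∈ t, CoeffLe v 1 (f i)) : CoeffLe v 1 (∏ i ∈ t, f i) := by
  simpa using CoeffLe.prod (γ := fun _ => 1) h

omit [Fintype F] in
theorem CoeffLe.prod_sub_prod {ι : Type*} {t : Finset ι} {f g : ι → KPoly F s}
    (hf : ∀ i ∈ t, CoeffLe v 1 (f i)) (hg : ∀ i ∈ t, CoeffLe v 1 (g i))
    (h : ∀ i ∈ t, CoeffLe v γ (f i - g i)) :
    CoeffLe v γ (∏ i ∈ t, f i - ∏ i ∈ t, g i) := by
  classical
  induction t using Finset.induction_on with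
  | empty => simpa using coeffLe_zero
  | insert i t hi ih =>
    rw [Finset.forall_mem_insert] at hf hg h
    have h1 := ih hf.2 hg.2 h.2
    have h2 : f i * ∏ i ∈ t, f i - g i * ∏ i ∈ t, g i =
        (f i - g i) * ∏ i ∈ t, f i + g i * (∏ i ∈ t, f i - ∏ i ∈ t, g i) := by ring
    rw [Finset.prod_insert hi, Finset.prod_insert hi, h2]
    refine CoeffLe.add ?_ ?_
    · simpa using h.1.mul (CoeffLe.one_prod hf.2)
    · simpa using hg.1.mul h1

theorem CoeffLe.eval₂_X {p : F[X][X]} (h : ∀ i, v (algebraMap F[X] (RatFunc F) (p.coeff i)) ≤ γ)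
    (k : Fin s) : CoeffLe v γ (p.eval₂ (constA F s) (MvPolynomial.X k)) := by
  rw [eval₂_eq_sum, Polynomial.sum]
  refine CoeffLe.sum fun i _ => ?_
  have hX : CoeffLe v 1 (MvPolynomial.X k ^ i : KPoly F s) := by
    simpa using CoeffLe.one_prod (t := Finset.range i) fun _ _ => coeffLe_X (v := v) k
  simpa only [mul_one] using! (coeffLe_C (h i)).mul hX

theorem coeff_iterate_map_frobenius (j : ℕ) (f : KPoly F s) (m : Fin s →₀ ℕ) :
    MvPolynomial.coeff m ((MvPolynomial.map (FiniteField.frobeniusAlgHom F (RatFunc F) :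
        RatFunc F →+* RatFunc F))^[j] f) = MvPolynomial.coeff m f ^ q ^ j := by
  induction j with
  | zero => simp
  | succ j ih =>
    rw [Function.iterate_succ_apply', MvPolynomial.coeff_map, ih, RingHom.coe_coe,
      FiniteField.frobeniusAlgHom_apply, ← pow_mul, pow_succ]

theorem coeffLe_thetaTau_pow (hθ : v RatFunc.X ≤ 1) {f : PowerSeries (KPoly F s)}
    (hf : ∀ n, CoeffLe v 1 (PowerSeries.coeff n f)) (i n : ℕ) :
    CoeffLe v 1 (PowerSeries.coeff n ((thetaTau F s ^ i) f)) := by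
  induction i generalizing n with
  | zero => exact hf n
  | succ i ih =>
    have hi : (thetaTau F s ^ (i + 1)) f = thetaTau F s ((thetaTau F s ^ i) f) := by
      rw [pow_succ']
      rfl
    rw [hi, thetaTau_apply, map_add, PowerSeries.coeff_C_mul]
    refine CoeffLe.add (by simpa using (coeffLe_C hθ).mul (ih n)) ?_
    cases n with
    | zero =>
      rw [coeff_zero_tauZ]
      exact coeffLe_zero
    | succ n =>
      rw [coeff_succ_tauZ]
      simpa using (ih n).tau hθ le_rfl

theorem coeffLe_leftEval (hθ : v RatFunc.X ≤ 1) {f : PowerSeries (KPoly F s)}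
    (hf : ∀ n, CoeffLe v 1 (PowerSeries.coeff n f)) {p : F[X][X]}
    (h : ∀ i, v (algebraMap F[X] (RatFunc F) (p.coeff i)) ≤ γ) (n : ℕ) :
    CoeffLe v γ (PowerSeries.coeff n (leftEval F s p f)) := by
  rw [leftEval_apply, Polynomial.sum, map_sum]
  refine CoeffLe.sum fun i _ => ?_
  rw [PowerSeries.coeff_C_mul]
  simpa only [mul_one] using! (coeffLe_C (h i)).mul (coeffLe_thetaTau_pow hθ hf i n)

end

/-! ### Integrality of the coefficients of `σ_s` at each prime. -/

section Adic

open IsDedekindDomain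

variable {v : HeightOneSpectrum F[X]} {P : F[X]}

omit [Fintype F] in
theorem valuation_X_le_one : v.valuation (RatFunc F) RatFunc.X ≤ 1 := by
  rw [← RatFunc.algebraMap_X]
  exact v.valuation_le_one X

omit [Fintype F] in
theorem valuation_algebraMap_le_one (c : F) :
    v.valuation (RatFunc F) (algebraMap F (RatFunc F) c) ≤ 1 := by
  rw [IsScalarTower.algebraMap_apply F F[X] (RatFunc F)]
  exact v.valuation_le_one (C c)

omit [Fintype F] in
theorem coeffLe_prodEval (a : F[X]) : CoeffLe (v.valuation (RatFunc F)) 1 (prodEval F s a) :=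
  CoeffLe.one_prod fun i _ => CoeffLe.aeval valuation_algebraMap_le_one a i

/-- Modulo `P`, `C_P(τ_z) ≡ b_d(θ + τ_z) = τ_z^d`, and `τ_z^d f = z^d ∏ b_d(t_k) φ^d(f) ≡ z^d ∏
P(t_k) f`, by `b_d ≡ P(t)` and `x^{q^d} ≡ x`. -/
theorem coeffLe_primeOp (hv : v.asIdeal = Ideal.span {P}) (hP : Irreducible P) (hm : P.Monic)
    {f : PowerSeries (KPoly F s)}
    (hf : ∀ n, CoeffLe (v.valuation (RatFunc F)) 1 (PowerSeries.coeff n f)) (n : ℕ) :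
    CoeffLe (v.valuation (RatFunc F))
      (v.valuation (RatFunc F) (algebraMap F[X] (RatFunc F) P))
      (PowerSeries.coeff n (primeOp F s P f)) := by
  set d := P.natDegree with hd
  have hb (i : ℕ) : v.valuation (RatFunc F)
      (algebraMap F[X] (RatFunc F) ((bPoly F d - P.map C).coeff i)) ≤
      v.valuation (RatFunc F) (algebraMap F[X] (RatFunc F) P) :=
    valuation_le_of_dvd (dvd_coeff_bPoly_sub hP hm i)
  have h1 : primeOp F s P f =
      ((tauZ F s)^[d] f - PowerSeries.X ^ d * (PowerSeries.C (prodEval F s P) * f)) -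
        leftEval F s (bPoly F d - P.map C) f := by
    rw [primeOp, iterate_tauZ_eq_leftEval, leftEval_sub]
    abel
  rw [h1, map_sub]
  refine CoeffLe.sub ?_ (coeffLe_leftEval valuation_X_le_one hf hb n)
  rw [map_sub]
  rcases lt_or_ge n d with h | h
  · rw [coeff_tauZ_iterate_eq_zero F s f h, PowerSeries.coeff_X_pow_mul', if_neg (by omega),
      sub_zero]
    exact coeffLe_zero
  · obtain ⟨m, rfl⟩ := Nat.exists_eq_add_of_le h
    rw [coeff_add_iterate_tauZ, add_comm d m, PowerSeries.coeff_X_pow_mul,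
      PowerSeries.coeff_C_mul, iterate_tau_eq]
    set f' := PowerSeries.coeff m f
    set B := ∏ k, (bPoly F d).eval₂ (constA F s) (MvPolynomial.X k) with hB
    set f'' := (MvPolynomial.map (FiniteField.frobeniusAlgHom F (RatFunc F) :
        RatFunc F →+* RatFunc F))^[d] f'
    have h2 : B * f'' - prodEval F s P * f' =
        (B - prodEval F s P) * f'' + prodEval F s P * (f'' - f') := by ring
    have h3 : CoeffLe (v.valuation (RatFunc F)) 1 f'' := fun k => by
      rw [coeff_iterate_map_frobenius, map_pow]
      exact pow_le_one' (hf m k) _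
    rw [h2]
    refine CoeffLe.add ?_ ?_
    · rw [← mul_one (v.valuation (RatFunc F) (algebraMap F[X] (RatFunc F) P))]
      refine CoeffLe.mul ?_ h3
      refine CoeffLe.prod_sub_prod (fun k _ => CoeffLe.eval₂_X (fun i => v.valuation_le_one _) k)
        (fun k _ => CoeffLe.aeval valuation_algebraMap_le_one P k) fun k _ => ?_
      rw [← eval₂_map_C_eq_aeval, ← eval₂_sub]
      exact CoeffLe.eval₂_X hb k
    · rw [← one_mul (v.valuation (RatFunc F) (algebraMap F[X] (RatFunc F) P))]
      refine CoeffLe.mul (coeffLe_prodEval P) fun k => ?_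
      rw [MvPolynomial.coeff_sub, coeff_iterate_map_frobenius]
      exact valuation_pow_sub_le hv hP (hf m k)

theorem coeffLe_lSeries_sub (hv : v.asIdeal = Ideal.span {P}) (hm : P.Monic) (n : ℕ) :
    CoeffLe (v.valuation (RatFunc F)) 1 (PowerSeries.coeff n (lSeries F s -
      PowerSeries.X ^ P.natDegree *
        (PowerSeries.C (invC F s P * prodEval F s P) * lSeries F s))) := by
  classical
  rw [coeff_lSeries_sub hm]
  refine CoeffLe.sum fun a ha => ?_
  rw [Finset.mem_filter] at ha
  rw [← one_mul (1 : WithZero (Multiplicative ℤ))]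
  refine (coeffLe_C ?_).mul (coeffLe_prodEval a)
  rw [map_inv₀, valuation_eq_one_of_not_dvd hv ha.2, inv_one]

theorem coeffLe_iterate_tau {f : KPoly F s} (hf : CoeffLe (v.valuation (RatFunc F)) 1 f) (j : ℕ) :
    CoeffLe (v.valuation (RatFunc F)) 1 ((tau F s)^[j] f) := by
  induction j with
  | zero => exact hf
  | succ j ih =>
    rw [Function.iterate_succ_apply']
    simpa using ih.tau valuation_X_le_one le_rfl

/-- `τ_z^j` raises the constant `P` to the power `q^j`, and `P^{q^j} / D_j` still contains a factor
`P`. -/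
theorem coeffLe_expZ_constA_mul (hv : v.asIdeal = Ideal.span {P}) (hP : Irreducible P)
    {f : PowerSeries (KPoly F s)}
    (hf : ∀ n, CoeffLe (v.valuation (RatFunc F)) 1 (PowerSeries.coeff n f)) (n : ℕ) :
    CoeffLe (v.valuation (RatFunc F))
      (v.valuation (RatFunc F) (algebraMap F[X] (RatFunc F) P))
      (PowerSeries.coeff n (expZ F s (PowerSeries.C (constA F s P) * f))) := by
  rw [coeff_expZ]
  refine CoeffLe.sum fun p _ => ?_
  rw [PowerSeries.coeff_C_mul, constA_apply, iterate_tau_C_mul, ← mul_assoc, invC, ← map_mul,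
    ← mul_one (v.valuation (RatFunc F) (algebraMap F[X] (RatFunc F) P))]
  exact (coeffLe_C (valuation_inv_carlitzD_mul_le hv hP p.1)).mul
    (coeffLe_iterate_tau (hf p.2) p.1)

theorem coeffLe_sigma (v : HeightOneSpectrum F[X]) (n : ℕ) :
    CoeffLe (v.valuation (RatFunc F)) 1 (PowerSeries.coeff n (sigma F s)) := by
  obtain ⟨P, hP, hm, hv⟩ := exists_monic_generator v
  have hP0 : algebraMap F[X] (RatFunc F) P ≠ 0 :=
    (map_ne_zero_iff _ (IsFractionRing.injective _ _)).2 hP.ne_zero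
  induction n using Nat.strong_induction_on with
  | _ n ih =>
    -- `g` is the part of `σ_s` already known to be integral. Applying `primeOp` to `σ_s - g`
    -- isolates `P` times the `n`-th coefficient, while both `primeOp σ_s` and `primeOp g` are
    -- divisible by `P`.
    set g : PowerSeries (KPoly F s) :=
      PowerSeries.mk fun m => if m < n then PowerSeries.coeff m (sigma F s) else 0 with hg
    have hg1 (m : ℕ) : CoeffLe (v.valuation (RatFunc F)) 1 (PowerSeries.coeff m g) := by
      rw [hg, PowerSeries.coeff_mk]
      split_ifs with h
      · exact ih m h
      · exact coeffLe_zero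
    have hh (m : ℕ) (h : m < n) : PowerSeries.coeff m (sigma F s - g) = 0 := by
      rw [map_sub, hg, PowerSeries.coeff_mk, if_pos h, sub_self]
    have h1 := coeff_primeOp hP.natDegree_pos.ne' hh
    have h2 : PowerSeries.coeff n (sigma F s - g) = PowerSeries.coeff n (sigma F s) := by
      rw [map_sub, hg, PowerSeries.coeff_mk, if_neg (lt_irrefl n), sub_zero]
    have h3 : primeOp F s P (sigma F s - g) =
        primeOp F s P (sigma F s) - primeOp F s P g := by
      rw [eq_sub_iff_add_eq, ← primeOp_add, sub_add_cancel]
    have h4 : CoeffLe (v.valuation (RatFunc F))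
        (v.valuation (RatFunc F) (algebraMap F[X] (RatFunc F) P))
        (constA F s P * PowerSeries.coeff n (sigma F s)) := by
      rw [← h2, ← h1, h3, map_sub, primeOp_sigma hm]
      exact (coeffLe_expZ_constA_mul hv hP (coeffLe_lSeries_sub hv hm) n).sub
        (coeffLe_primeOp hv hP hm hg1 n)
    have h5 := (coeffLe_C (s := s) (v := v.valuation (RatFunc F))
      (c := (algebraMap F[X] (RatFunc F) P)⁻¹) le_rfl).mul h4
    rw [← mul_assoc, constA_apply, ← map_mul, ← map_mul, inv_mul_cancel₀ hP0, map_one, map_one,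
      one_mul] at h5
    exact h5

theorem coeff_sigma_mem_range (n : ℕ) :
    PowerSeries.coeff n (sigma F s) ∈ Set.range (incl F s) := by
  rw [incl, MvPolynomial.mem_range_map_iff_coeffs_subset]
  intro x hx
  obtain ⟨m, -, rfl⟩ := MvPolynomial.mem_coeffs_iff.1 hx
  exact HeightOneSpectrum.mem_integers_of_valuation_le_one (RatFunc F) _
    fun v => coeffLe_sigma v n m

end Adic

end Integrality

/-! ### The degree of `σ_s` in `z` -/

section Degree

variable [Fintype F]

omit [Fintype F] in
open WithZero in
theorem inftyValuation_algebraMap [DecidableEq (RatFunc F)] {a : F[X]} (ha : a ≠ 0) :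
    RatFunc.inftyValuation F (algebraMap F[X] (RatFunc F) a) = exp (a.natDegree : ℤ) :=
  RatFunc.inftyValuation.polynomial F ha

theorem natDegree_carlitzD (j : ℕ) : (carlitzD F j).natDegree = j * q ^ j := by
  induction j with
  | zero => simp [carlitzD]
  | succ j ih =>
    rw [carlitzD, natDegree_mul (X_pow_card_pow_sub_X_ne_zero j)
      (pow_ne_zero _ (carlitzD_ne_zero j)), natDegree_pow, ih,
      FiniteField.X_pow_card_pow_sub_X_natDegree_eq F (Nat.succ_ne_zero j) Fintype.one_lt_card,
      Nat.succ_eq_add_one]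
    ring

section

open WithZero

variable [DecidableEq (RatFunc F)]

theorem coeffLe_infty_lSeries (d : ℕ) :
    CoeffLe (RatFunc.inftyValuation F) (exp (-(d : ℤ)))
      (PowerSeries.coeff d (lSeries F s)) := by
  rw [coeff_lSeries]
  refine CoeffLe.sum fun a ha => ?_
  rw [mem_monics] at ha
  rw [← mul_one (exp (-(d : ℤ)))]
  refine (coeffLe_C ?_).mul (CoeffLe.one_prod fun i _ => CoeffLe.aeval (fun c => ?_) a i)
  · rw [map_inv₀, inftyValuation_algebraMap ha.1.ne_zero, ha.2, exp_neg]
  · rcases eq_or_ne c 0 with rfl | hc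
    · simp
    · rw [RatFunc.algebraMap_eq_C, RatFunc.inftyValuation.C F hc]

/-- `τ` sends a degree bound `e` to `q e + s ≤ q (e + n) - n`; the latter affine map fixes `-n`,
hence the closed form of its iterates. -/
theorem coeffLe_infty_iterate_tau {f : KPoly F s} {e : ℤ} {n : ℕ} (hn : s ≤ n * (q - 1))
    (hf : CoeffLe (RatFunc.inftyValuation F) (exp e) f) (j : ℕ) :
    CoeffLe (RatFunc.inftyValuation F) (exp ((q : ℤ) ^ j * (e + n) - n))
      ((tau F s)^[j] f) := by
  induction j with
  | zero => simpa using hf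
  | succ j ih =>
    rw [Function.iterate_succ_apply']
    refine (ih.tau (δ := exp 1) ?_ ?_).mono ?_
    · rw [RatFunc.inftyValuation.X]
    · rw [← exp_zero, exp_le_exp]
      exact zero_le_one
    · rw [← exp_nsmul, ← exp_nsmul, ← exp_add, exp_le_exp]
      have h1 : (s : ℤ) ≤ n * (q - 1) := by
        have h2 : (1 : ℕ) ≤ q := Fintype.card_pos
        have h3 : ((q - 1 : ℕ) : ℤ) = (q : ℤ) - 1 := by push_cast [h2]; ring
        rw [← h3]
        exact_mod_cast hn
      simp only [nsmul_eq_mul, mul_one]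
      linear_combination h1

/-- In the term with `τ^j` applied to the coefficient of index `n - j`, the bound is `j q^j - n`,
and division by `D_j`, of degree `j q^j`, leaves exactly `-n`. -/
theorem coeffLe_infty_sigma {n : ℕ} (hn : s ≤ n * (q - 1)) :
    CoeffLe (RatFunc.inftyValuation F) (exp (-(n : ℤ)))
      (PowerSeries.coeff n (sigma F s)) := by
  rw [sigma, coeff_expZ]
  refine CoeffLe.sum fun p hp => ?_
  rw [Finset.HasAntidiagonal.mem_antidiagonal] at hp
  have h1 := coeffLe_infty_iterate_tau hn (coeffLe_infty_lSeries (F := F) (s := s) p.2) p.1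
  refine (CoeffLe.mul (coeffLe_C le_rfl) h1).mono (le_of_eq ?_)
  rw [map_inv₀, inftyValuation_algebraMap (carlitzD_ne_zero p.1), natDegree_carlitzD, ← exp_neg,
    ← exp_add, ← hp]
  congr 1
  push_cast
  ring

end

theorem coeff_sigma_eq_zero {n : ℕ} (h0 : n ≠ 0) (hn : s ≤ n * (q - 1)) :
    PowerSeries.coeff n (sigma F s) = 0 := by
  classical
  obtain ⟨f, hf⟩ := coeff_sigma_mem_range (F := F) (s := s) n
  have h := coeffLe_infty_sigma (F := F) hn
  rw [← hf] at h ⊢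
  ext m
  have hm := h m
  rw [incl, MvPolynomial.coeff_map] at hm ⊢
  rw [MvPolynomial.coeff_zero]
  by_contra hne
  have hc : MvPolynomial.coeff m f ≠ 0 := fun h => hne (by rw [h, map_zero])
  rw [inftyValuation_algebraMap hc, WithZero.exp_le_exp] at hm
  omega

/-- `σ_s` as a polynomial over `A[t_1, …, t_s]`. -/
theorem exists_sigma_polynomial : ∃ σ : Polynomial (MvPolynomial (Fin s) F[X]),
    (σ.map (incl F s) : PowerSeries (KPoly F s)) = sigma F s := by
  choose f hf using coeff_sigma_mem_range (F := F) (s := s)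
  -- The crude bound `n ≤ s` suffices here, because `q - 1 ≥ 1`.
  refine ⟨∑ n ∈ Finset.range (s + 1), monomial n (f n), ?_⟩
  ext1 n
  rw [Polynomial.coeff_coe, coeff_map, finsetSum_coeff]
  simp only [coeff_monomial, Finset.sum_ite_eq', Finset.mem_range]
  split_ifs with h
  · exact hf n
  · rw [map_zero, coeff_sigma_eq_zero (by omega)]
    have h1 : 1 < q := Fintype.one_lt_card
    have h2 : s * 1 ≤ n * (q - 1) := Nat.mul_le_mul (by omega) (by omega)
    omega

omit [Fintype F] in
theorem incl_injective : Function.Injective (incl F s) :=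
  MvPolynomial.map_injective _ (IsFractionRing.injective _ _)

theorem natDegree_sigma_le (hs : 1 ≤ s) {σ : Polynomial (MvPolynomial (Fin s) F[X])}
    (hσ : (σ.map (incl F s) : PowerSeries (KPoly F s)) = sigma F s) :
    (σ.natDegree : ℚ) ≤ ((s : ℚ) - 1) / ((q : ℚ) - 1) := by
  have h1 : (1 : ℚ) < q := by exact_mod_cast Fintype.one_lt_card
  have hs' : (1 : ℚ) ≤ s := by exact_mod_cast hs
  rw [le_div_iff₀ (by linarith)]
  by_contra! h
  have h0 : σ.natDegree ≠ 0 := by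
    intro h0
    rw [h0] at h
    simp only [Nat.cast_zero, zero_mul] at h
    linarith
  have hn : s ≤ σ.natDegree * (q - 1) := by
    have h2 : 1 ≤ q := Fintype.card_pos
    have h3 : (s : ℚ) < ((σ.natDegree * (q - 1) + 1 : ℕ) : ℚ) := by
      push_cast [h2]
      linarith
    have h4 : s < σ.natDegree * (q - 1) + 1 := by exact_mod_cast h3
    omega
  have h5 := coeff_sigma_eq_zero h0 hn
  rw [← hσ, Polynomial.coeff_coe, coeff_map, map_eq_zero_iff _ incl_injective] at h5
  rw [coeff_natDegree, leadingCoeff_eq_zero] at h5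
  exact h0 (by rw [h5, natDegree_zero])

end Degree

/-! ### The relation between `σ_s` and `𝕊_s` -/

section Relation

variable [Fintype F]

section Carlitz

variable {M : Type*} [CommRing M] [Algebra F M] [Algebra F[X] M]

theorem carlitz_one (m : M) : carlitz F M 1 m = m := by
  rw [map_one]
  rfl

theorem carlitz_X_mul (a : F[X]) (m : M) :
    carlitz F M (X * a) m = algebraMap F[X] M X * carlitz F M a m + carlitz F M a m ^ q := by
  rw [map_mul]
  have : carlitz F M X = LinearMap.mulLeft F (algebraMap F[X] M X) +
      (FiniteField.frobeniusAlgHom F M).toLinearMap := aeval_X _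
  rw [this]
  rfl

theorem carlitz_eq_sum (a : F[X]) (m : M) :
    carlitz F M a m = ∑ i ∈ a.support, a.coeff i • carlitz F M (X ^ i) m := by
  conv_lhs => rw [a.as_sum_support]
  rw [map_sum, LinearMap.sum_apply]
  refine Finset.sum_congr rfl fun i _ => ?_
  rw [← C_mul_X_pow_eq_monomial, ← smul_eq_C_mul, map_smul, LinearMap.smul_apply]

end Carlitz

/-- The `K`-linear map `K[t] → K[X_1, …, X_s]` sending `t^i` to `C_{θ^i}(X_k)`. -/
def carlitzLin (F : Type*) [Field F] [Fintype F] (s : ℕ) (k : Fin s) :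
    (RatFunc F)[X] →ₗ[RatFunc F] KPoly F s :=
  (Polynomial.basisMonomials (RatFunc F)).constr (RatFunc F)
    fun i => carlitz F (KPoly F s) (X ^ i) (MvPolynomial.X k)

/-- The `K`-linear map sending `t_1^{m_1} ⋯ t_s^{m_s}` to `∏ C_{θ^{m_k}}(X_k)`. -/
def carlitzTensor (F : Type*) [Field F] [Fintype F] (s : ℕ) :
    KPoly F s →ₗ[RatFunc F] KPoly F s :=
  (MvPolynomial.basisMonomials (Fin s) (RatFunc F)).constr (RatFunc F)
    fun m => ∏ k, carlitz F (KPoly F s) (X ^ m k) (MvPolynomial.X k)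

theorem carlitzLin_monomial (k : Fin s) (i : ℕ) (c : RatFunc F) :
    carlitzLin F s k (monomial i c) = c • carlitz F (KPoly F s) (X ^ i) (MvPolynomial.X k) := by
  have h : (monomial i c : (RatFunc F)[X]) = c • Polynomial.basisMonomials (RatFunc F) i := by
    rw [coe_basisMonomials, smul_monomial, smul_eq_mul, mul_one]
  rw [h, map_smul, carlitzLin, Module.Basis.constr_basis]

theorem carlitzTensor_monomial (m : Fin s →₀ ℕ) (c : RatFunc F) :
    carlitzTensor F s (MvPolynomial.monomial m c) =
      c • ∏ k, carlitz F (KPoly F s) (X ^ m k) (MvPolynomial.X k) := by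
  have h : (MvPolynomial.monomial m c : KPoly F s) =
      c • MvPolynomial.basisMonomials (Fin s) (RatFunc F) m := by
    rw [MvPolynomial.coe_basisMonomials, MvPolynomial.smul_monomial, smul_eq_mul, mul_one]
  rw [h, map_smul, carlitzTensor, Module.Basis.constr_basis]

omit [Fintype F] in
theorem prod_aeval_X (p : Fin s → (RatFunc F)[X]) :
    (∏ k, aeval (MvPolynomial.X k) (p k) : KPoly F s) =
      ∑ x ∈ Fintype.piFinset fun k => (p k).support,
        MvPolynomial.monomial (Finsupp.equivFunOnFinite.symm x) (∏ k, (p k).coeff (x k)) := by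
  have h1 (k : Fin s) : aeval (MvPolynomial.X k : KPoly F s) (p k) =
      ∑ i ∈ (p k).support, MvPolynomial.C ((p k).coeff i) * MvPolynomial.X k ^ i := by
    rw [aeval_def, eval₂_eq_sum, Polynomial.sum]
    rfl
  simp only [h1, Finset.prod_univ_sum]
  refine Finset.sum_congr rfl fun x _ => ?_
  rw [Finset.prod_mul_distrib, ← map_prod, MvPolynomial.monomial_eq,
    Finsupp.prod_fintype _ _ fun _ => pow_zero _]
  rfl

theorem carlitzTensor_prod (p : Fin s → (RatFunc F)[X]) :
    carlitzTensor F s (∏ k, aeval (MvPolynomial.X k) (p k)) = ∏ k, carlitzLin F s k (p k) := by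
  have h2 (k : Fin s) : carlitzLin F s k (p k) =
      ∑ i ∈ (p k).support, MvPolynomial.C ((p k).coeff i) *
        carlitz F (KPoly F s) (X ^ i) (MvPolynomial.X k) := by
    conv_lhs => rw [(p k).as_sum_support]
    rw [map_sum]
    refine Finset.sum_congr rfl fun i _ => ?_
    rw [carlitzLin_monomial, MvPolynomial.smul_eq_C_mul]
  simp only [prod_aeval_X, h2, Finset.prod_univ_sum, map_sum]
  refine Finset.sum_congr rfl fun x _ => ?_
  rw [carlitzTensor_monomial, Finset.prod_mul_distrib, ← map_prod, MvPolynomial.smul_eq_C_mul]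
  rfl

theorem carlitzLin_map (k : Fin s) (a : F[X]) :
    carlitzLin F s k (a.map (algebraMap F (RatFunc F))) =
      carlitz F (KPoly F s) a (MvPolynomial.X k) := by
  conv_lhs => rw [a.as_sum_support]
  rw [carlitz_eq_sum, Polynomial.map_sum, map_sum]
  refine Finset.sum_congr rfl fun i _ => ?_
  rw [map_monomial, carlitzLin_monomial, algebraMap_smul]

theorem carlitzTensor_prodEval (a : F[X]) :
    carlitzTensor F s (prodEval F s a) =
      ∏ k, carlitz F (KPoly F s) a (MvPolynomial.X k) := by
  rw [← Finset.prod_congr rfl fun k _ => carlitzLin_map (s := s) k a, ← carlitzTensor_prod]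
  congr 1
  refine Finset.prod_congr rfl fun k _ => ?_
  rw [aeval_map_algebraMap]

omit [Fintype F] in
theorem algebraMap_X_eq : algebraMap F[X] (KPoly F s) X = MvPolynomial.C RatFunc.X := by
  rw [MvPolynomial.algebraMap_apply, RatFunc.algebraMap_X]

theorem add_pow_card (f g : KPoly F s) : (f + g) ^ q = f ^ q + g ^ q :=
  map_add (FiniteField.frobeniusAlgHom F (KPoly F s)) f g

/-- In each variable `(t - θ) t^i` goes to `C_{θ^{i+1}}(X) - θ C_{θ^i}(X) = C_{θ^i}(X)^q`; this is
why the factors `t_k - θ` occur in `τ_z`. -/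
theorem carlitzTensor_tau (f : KPoly F s) :
    carlitzTensor F s (tau F s f) = carlitzTensor F s f ^ q := by
  induction f using MvPolynomial.induction_on' with
  | add f g hf hg => rw [map_add, map_add, map_add, hf, hg, add_pow_card]
  | monomial m c =>
    have h1 : (MvPolynomial.monomial m c : KPoly F s) =
        MvPolynomial.C c * ∏ k, MvPolynomial.X k ^ m k := by
      rw [MvPolynomial.monomial_eq, Finsupp.prod_fintype _ _ fun _ => pow_zero _]
    have h2 : tau F s (∏ k, MvPolynomial.X k ^ m k) =
        ∏ k, aeval (MvPolynomial.X k) ((X - C RatFunc.X) * X ^ m k : (RatFunc F)[X]) := by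
      rw [tau_apply, map_prod, ← Finset.prod_mul_distrib]
      refine Finset.prod_congr rfl fun k _ => ?_
      rw [map_pow, MvPolynomial.map_X, map_mul, map_sub, aeval_X, aeval_C, map_pow, aeval_X]
      rfl
    have h3 (k : Fin s) : carlitzLin F s k ((X - C RatFunc.X) * X ^ m k) =
        carlitz F (KPoly F s) (X ^ m k) (MvPolynomial.X k) ^ q := by
      rw [sub_mul, ← pow_succ', C_mul_X_pow_eq_monomial, X_pow_eq_monomial, map_sub,
        carlitzLin_monomial, carlitzLin_monomial, one_smul, pow_succ', carlitz_X_mul,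
        algebraMap_X_eq, MvPolynomial.smul_eq_C_mul, add_sub_cancel_left]
    rw [carlitzTensor_monomial, h1, tau_C_mul, h2, ← MvPolynomial.smul_eq_C_mul, map_smul,
      carlitzTensor_prod, _root_.smul_pow, ← Finset.prod_pow]
    simp only [h3]

/-! ### Series in the powers `Z^{q^k}`, and the identification of `𝕊_s`. -/

/-- The power series `∑ c_k Z^{q^k}`. -/
def lacunary (F : Type*) [Field F] [Fintype F] (s : ℕ) (c : ℕ → KPoly F s) :
    PowerSeries (KPoly F s) :=
  PowerSeries.mk fun n =>
    ∑ k ∈ Finset.range (n + 1), if n = Fintype.card F ^ k then c k else 0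

theorem coeff_lacunary_pow (c : ℕ → KPoly F s) (n : ℕ) :
    PowerSeries.coeff (q ^ n) (lacunary F s c) = c n := by
  rw [lacunary, PowerSeries.coeff_mk, Finset.sum_eq_single n, if_pos rfl]
  · intro k _ hk
    rw [if_neg fun h => hk (Nat.pow_right_injective Fintype.one_lt_card h).symm]
  · intro h
    exact (h (Finset.mem_range.2 ((Nat.lt_pow_self Fintype.one_lt_card).trans
      (Nat.lt_succ_self _)))).elim

theorem coeff_lacunary_of_ne (c : ℕ → KPoly F s) {n : ℕ} (h : ∀ k, n ≠ q ^ k) :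
    PowerSeries.coeff n (lacunary F s c) = 0 := by
  rw [lacunary, PowerSeries.coeff_mk]
  exact Finset.sum_eq_zero fun k _ => if_neg (h k)

theorem pow_card_eq_map_expand (f : PowerSeries (KPoly F s)) :
    f ^ q = PowerSeries.map (FiniteField.frobeniusAlgHom F (KPoly F s) : KPoly F s →+* KPoly F s)
      (PowerSeries.expand q Fintype.card_ne_zero f) := by
  obtain ⟨p, hp, n, hprime, hcard⟩ := FiniteField.card' F
  have := Fact.mk hprime
  have : ExpChar F p := .prime hprime
  have : ExpChar (KPoly F s) p :=
    expChar_of_injective_algebraMap (algebraMap F (KPoly F s)).injective p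
  have hfrob : (FiniteField.frobeniusAlgHom F (KPoly F s) : KPoly F s →+* KPoly F s) =
      iterateFrobenius (KPoly F s) p n := by
    refine RingHom.ext fun x => ?_
    rw [RingHom.coe_coe, FiniteField.frobeniusAlgHom_apply, iterateFrobenius_def, hcard]
  -- A free exponent `Q` allows the substitution of `p ^ n`, impossible for the cardinality itself.
  have hexp (Q : ℕ) (hQ : Q ≠ 0) (h : Q = p ^ (n : ℕ)) :
      f ^ Q = PowerSeries.map (iterateFrobenius (KPoly F s) p n) (PowerSeries.expand Q hQ f) := by
    subst h
    exact (MvPowerSeries.map_iterateFrobenius_expand p hprime.ne_zero f n).symm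
  rw [hfrob]
  exact hexp _ _ hcard

theorem coeff_mul_pow_card (f : PowerSeries (KPoly F s)) (n : ℕ) :
    PowerSeries.coeff (q * n) (f ^ q) = PowerSeries.coeff n f ^ q := by
  rw [pow_card_eq_map_expand, PowerSeries.coeff_map, PowerSeries.coeff_expand_mul]
  rfl

theorem coeff_pow_card_of_not_dvd (f : PowerSeries (KPoly F s)) {n : ℕ} (h : ¬ q ∣ n) :
    PowerSeries.coeff n (f ^ q) = 0 := by
  rw [pow_card_eq_map_expand, PowerSeries.coeff_map, PowerSeries.coeff_expand_of_not_dvd _ _ _ h,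
    map_zero]

theorem lacunary_pow_card {c c' : ℕ → KPoly F s} (h0 : c' 0 = 0)
    (h : ∀ n, c' (n + 1) = c n ^ q) : lacunary F s c ^ q = lacunary F s c' := by
  ext1 n
  by_cases hn : ∃ k, n = q ^ k
  · obtain ⟨k, rfl⟩ := hn
    rw [coeff_lacunary_pow]
    cases k with
    | zero =>
      rw [h0, coeff_pow_card_of_not_dvd]
      rw [pow_zero, Nat.dvd_one]
      exact Fintype.one_lt_card.ne'
    | succ k => rw [h, pow_succ', coeff_mul_pow_card, coeff_lacunary_pow]
  · push Not at hn
    rw [coeff_lacunary_of_ne _ hn]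
    by_cases hd : q ∣ n
    · obtain ⟨m, rfl⟩ := hd
      rw [coeff_mul_pow_card, coeff_lacunary_of_ne, zero_pow Fintype.card_ne_zero]
      intro k hk
      exact hn (k + 1) (by rw [hk, pow_succ'])
    · exact coeff_pow_card_of_not_dvd _ hd

/-- A `q`-th power moves `Z^{q^n}` to `Z^{q^{n+1}}`, matching the factor `z` in `τ_z`; so `exp_C`
and `exp_z` correspond term by term. -/
theorem lacunary_carlitzTensor_pow (f : PowerSeries (KPoly F s)) (j : ℕ) :
    lacunary F s (fun n => carlitzTensor F s (PowerSeries.coeff n f)) ^ q ^ j =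
      lacunary F s (fun n => carlitzTensor F s (PowerSeries.coeff n ((tauZ F s)^[j] f))) := by
  induction j with
  | zero => rw [pow_zero, pow_one]; rfl
  | succ j ih =>
    rw [pow_succ, pow_mul, ih]
    refine lacunary_pow_card ?_ fun n => ?_
    · rw [Function.iterate_succ_apply', coeff_zero_tauZ, map_zero]
    · rw [Function.iterate_succ_apply', coeff_succ_tauZ, carlitzTensor_tau]

theorem littleL_eq : littleL F s (∏ i, MvPolynomial.X i) =
    lacunary F s (fun n => carlitzTensor F s (PowerSeries.coeff n (lSeries F s))) := by
  rw [littleL, lacunary]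
  congr 1
  ext1 n
  refine Finset.sum_congr rfl fun k _ => if_congr Iff.rfl ?_ rfl
  rw [bigL, coeff_lSeries, map_sum]
  refine Finset.sum_congr rfl fun a _ => ?_
  rw [invC, ← MvPolynomial.smul_eq_C_mul, ← MvPolynomial.smul_eq_C_mul, map_smul,
    carlitzTensor_prodEval, star, map_prod]
  simp only [MvPolynomial.aeval_X]

theorem coeff_specialS (n : ℕ) :
    PowerSeries.coeff n (specialS F s) = ∑ j ∈ Finset.range (n + 1),
      invC F s (carlitzD F j) * PowerSeries.coeff n (lacunary F s
        (fun n => carlitzTensor F s (PowerSeries.coeff n ((tauZ F s)^[j] (lSeries F s))))) := by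
  rw [specialS, expC, PowerSeries.coeff_mk, littleL_eq]
  simp only [lacunary_carlitzTensor_pow]

theorem specialS_eq : specialS F s =
    lacunary F s (fun n => carlitzTensor F s (PowerSeries.coeff n (sigma F s))) := by
  ext1 n
  rw [coeff_specialS]
  by_cases hn : ∃ k, n = q ^ k
  · obtain ⟨k, rfl⟩ := hn
    simp only [coeff_lacunary_pow]
    rw [sigma, expZ, PowerSeries.coeff_mk, map_sum]
    symm
    rw [Finset.sum_congr rfl fun j _ => by rw [invC, ← MvPolynomial.smul_eq_C_mul, map_smul,
      MvPolynomial.smul_eq_C_mul, ← invC]]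
    -- `expC` truncates at `q^k` and `expZ` at `k`; the extra terms vanish.
    refine Finset.sum_subset (Finset.range_subset_range.2 (Nat.succ_le_succ
      (Nat.lt_pow_self Fintype.one_lt_card).le)) fun j _ hj => ?_
    rw [coeff_tauZ_iterate_eq_zero F s _ (by simpa using hj), map_zero, mul_zero]
  · push Not at hn
    rw [coeff_lacunary_of_ne _ hn]
    exact Finset.sum_eq_zero fun j _ => by rw [coeff_lacunary_of_ne _ hn, mul_zero]

omit [Fintype F] in
theorem coeff_prod_aeval_X (p : Fin s → (RatFunc F)[X]) (m : Fin s →₀ ℕ) :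
    MvPolynomial.coeff m (∏ k, aeval (MvPolynomial.X k) (p k) : KPoly F s) =
      ∏ k, (p k).coeff (m k) := by
  classical
  rw [prod_aeval_X, MvPolynomial.coeff_sum]
  simp only [MvPolynomial.coeff_monomial]
  rw [Finset.sum_eq_single (m : Fin s → ℕ)]
  · rw [if_pos (by ext; rfl)]
  · intro x _ hx
    rw [if_neg]
    rintro rfl
    exact hx rfl
  · intro hm
    rw [if_pos (by ext; rfl)]
    simp only [Fintype.mem_piFinset, not_forall, mem_support_iff, not_not] at hm
    obtain ⟨k, hk⟩ := hm
    exact Finset.prod_eq_zero (Finset.mem_univ k) hk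

theorem exists_carlitz_X_pow_eq (k : Fin s) (i : ℕ) : ∃ p : (RatFunc F)[X],
    carlitz F (KPoly F s) (X ^ i) (MvPolynomial.X k) = aeval (MvPolynomial.X k) p ∧
      p.Monic ∧ p.natDegree = q ^ i := by
  induction i with
  | zero => exact ⟨X, by rw [pow_zero, carlitz_one, aeval_X], monic_X, by simp⟩
  | succ i ih =>
    obtain ⟨p, hp, hm, hd⟩ := ih
    have h1 : (p ^ q).natDegree = q ^ (i + 1) := by rw [hm.natDegree_pow, hd, pow_succ']
    have h2 : (C RatFunc.X * p).natDegree < (p ^ q).natDegree := by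
      refine (natDegree_C_mul_le _ _).trans_lt ?_
      rw [h1, hd]
      exact Nat.pow_lt_pow_right Fintype.one_lt_card (Nat.lt_succ_self i)
    refine ⟨C RatFunc.X * p + p ^ q, ?_, (hm.pow q).add_of_right ?_, ?_⟩
    · rw [pow_succ', carlitz_X_mul, hp, algebraMap_X_eq, map_add, map_mul, map_pow, aeval_C]
      rfl
    · exact degree_lt_degree h2
    · rw [natDegree_add_eq_right_of_natDegree_lt h2, h1]

/-- Triangularity: `C_{θ^i}(X)` is monic of degree `q^i`. For `m` maximal in the support of `f`, any
other `m'` has some `m'_k < m_k`, so only `m` contributes to the monomial with exponents `q^{m_k}`.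
-/
theorem carlitzTensor_eq_zero_iff (f : KPoly F s) : carlitzTensor F s f = 0 ↔ f = 0 := by
  classical
  refine ⟨fun h => ?_, fun h => by rw [h, map_zero]⟩
  by_contra hf
  obtain ⟨m, hm⟩ := f.support.exists_maximal (MvPolynomial.support_nonempty.2 hf)
  choose p hp hmonic hdeg using exists_carlitz_X_pow_eq (F := F) (s := s)
  have h1 := congrArg (MvPolynomial.coeff (Finsupp.equivFunOnFinite.symm fun k => q ^ m k)) h
  rw [f.as_sum, map_sum, MvPolynomial.coeff_sum, MvPolynomial.coeff_zero,
    Finset.sum_eq_single m] at h1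
  · rw [carlitzTensor_monomial, Finset.prod_congr rfl fun k _ => hp k (m k),
      MvPolynomial.coeff_smul, coeff_prod_aeval_X] at h1
    rw [Finset.prod_eq_one, smul_eq_mul, mul_one] at h1
    · exact MvPolynomial.mem_support_iff.1 hm.1 h1
    · intro k _
      change (p k (m k)).coeff (q ^ m k) = 1
      rw [← hdeg k (m k)]
      exact (hmonic k (m k)).coeff_natDegree
  · intro m' hm' hne
    rw [carlitzTensor_monomial, Finset.prod_congr rfl fun k _ => hp k (m' k),
      MvPolynomial.coeff_smul, coeff_prod_aeval_X]
    have : ¬ m ≤ m' := fun hle => hne (le_antisymm (hm.2 hm' hle) hle)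
    rw [Finsupp.le_def] at this
    push Not at this
    obtain ⟨k, hk⟩ := this
    rw [Finset.prod_eq_zero (Finset.mem_univ k), smul_zero]
    refine coeff_eq_zero_of_natDegree_lt ?_
    rw [hdeg]
    exact Nat.pow_lt_pow_right Fintype.one_lt_card hk
  · intro h
    exact (h hm.1).elim

theorem constA_mem_range (a : F[X]) : constA F s a ∈ (incl F s).range :=
  ⟨MvPolynomial.C a, MvPolynomial.map_C _ _⟩

theorem carlitz_X_pow_mem_range (k : Fin s) (i : ℕ) :
    carlitz F (KPoly F s) (X ^ i) (MvPolynomial.X k) ∈ (incl F s).range := by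
  induction i with
  | zero =>
    rw [pow_zero, carlitz_one]
    exact ⟨MvPolynomial.X k, MvPolynomial.map_X _ _⟩
  | succ i ih =>
    rw [pow_succ', carlitz_X_mul]
    exact add_mem (mul_mem (constA_mem_range X) ih) (pow_mem ih _)

theorem carlitzTensor_mem_range {f : KPoly F s} (hf : f ∈ (incl F s).range) :
    carlitzTensor F s f ∈ (incl F s).range := by
  obtain ⟨g, rfl⟩ := hf
  rw [g.as_sum, map_sum, map_sum]
  refine sum_mem fun m _ => ?_
  rw [incl, MvPolynomial.map_monomial, carlitzTensor_monomial, MvPolynomial.smul_eq_C_mul]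
  exact mul_mem (constA_mem_range _) (prod_mem fun k _ => carlitz_X_pow_mem_range k _)

theorem coeff_sigma_eq_zero_of_lt {n : ℕ} (h : s < n) :
    PowerSeries.coeff n (sigma F s) = 0 := by
  refine coeff_sigma_eq_zero (by omega) ?_
  have h1 : 1 < q := Fintype.one_lt_card
  have h2 : s * 1 ≤ n * (q - 1) := Nat.mul_le_mul h.le (by omega)
  omega

theorem incl_eval_one_sigma {σ : Polynomial (MvPolynomial (Fin s) F[X])}
    (hσ : (σ.map (incl F s) : PowerSeries (KPoly F s)) = sigma F s) {M : ℕ} (hM : s < M) :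
    incl F s (σ.eval 1) = ∑ n ∈ Finset.range M, PowerSeries.coeff n (sigma F s) := by
  have hc (n : ℕ) : incl F s (σ.coeff n) = PowerSeries.coeff n (sigma F s) := by
    rw [← hσ, Polynomial.coeff_coe, coeff_map]
  have hd : σ.natDegree < M := by
    refine lt_of_le_of_lt (natDegree_le_iff_coeff_eq_zero.2 fun n hn => ?_) hM
    exact incl_injective (by rw [hc, coeff_sigma_eq_zero_of_lt hn, map_zero])
  rw [eval_eq_sum_range' hd, map_sum]
  exact Finset.sum_congr rfl fun n _ => by rw [one_pow, mul_one, hc]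

/-- `𝕊_s` as a polynomial over `A[X_1, …, X_s]`. -/
theorem exists_specialS_polynomial : ∃ S : Polynomial (MvPolynomial (Fin s) F[X]),
    (S.map (incl F s) : PowerSeries (KPoly F s)) = specialS F s ∧
      incl F s (S.eval 1) = carlitzTensor F s
        (∑ n ∈ Finset.range (s + 1), PowerSeries.coeff n (sigma F s)) := by
  have h (n : ℕ) : ∃ f, incl F s f = carlitzTensor F s (PowerSeries.coeff n (sigma F s)) :=
    carlitzTensor_mem_range (coeff_sigma_mem_range n)
  choose f hf using h
  refine ⟨∑ n ∈ Finset.range (s + 1), monomial (q ^ n) (f n), ?_, ?_⟩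
  · rw [specialS_eq]
    ext1 n
    rw [Polynomial.coeff_coe, coeff_map, finsetSum_coeff]
    simp only [coeff_monomial]
    by_cases hn : ∃ k, n = q ^ k
    · obtain ⟨k, rfl⟩ := hn
      rw [coeff_lacunary_pow]
      have hinj (j : ℕ) : q ^ j = q ^ k ↔ j = k :=
        (Nat.pow_right_injective Fintype.one_lt_card).eq_iff
      simp only [hinj, Finset.sum_ite_eq', Finset.mem_range]
      split_ifs with hk
      · exact hf k
      · rw [coeff_sigma_eq_zero_of_lt (by omega), map_zero, map_zero]
    · push Not at hn
      rw [coeff_lacunary_of_ne _ hn, Finset.sum_eq_zero, map_zero]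
      exact fun k _ => if_neg (hn k).symm
  · rw [eval_finsetSum, map_sum, map_sum]
    refine Finset.sum_congr rfl fun n _ => ?_
    rw [eval_monomial, one_pow, mul_one, hf]

end Relation

/-! ### Power sums and the value of `σ_s` at `z = 1` -/

section ValueAtOne

variable [Fintype F]

section PowerSums

/-- The polynomial of degree less than `D` with coefficients `c`. -/
def ofCoeffs {D : ℕ} (c : Fin D → F) : F[X] := ∑ i, C (c i) * X ^ (i : ℕ)

omit [Fintype F] in
theorem coeff_ofCoeffs {D : ℕ} (c : Fin D → F) (i : Fin D) : (ofCoeffs c).coeff i = c i := by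
  rw [ofCoeffs, finsetSum_coeff, Finset.sum_eq_single i]
  · simp
  · intro j _ hj
    rw [coeff_C_mul_X_pow, if_neg (fun h => hj (Fin.ext h.symm))]
  · simp

omit [Fintype F] in
theorem degree_ofCoeffs_lt {D : ℕ} (c : Fin D → F) : (ofCoeffs c).degree < D :=
  degree_sum_fin_lt c

variable {M : Type*} [AddCommMonoid M]

theorem sum_ofCoeffs_succ (D : ℕ) (f : F[X] → M) :
    ∑ c : Fin (D + 1) → F, f (ofCoeffs c) =
      ∑ x : F, ∑ c : Fin D → F, f (ofCoeffs c + C x * X ^ D) := by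
  rw [← (Fin.snocEquiv fun _ : Fin (D + 1) => F).sum_comp, Fintype.sum_prod_type]
  refine Finset.sum_congr rfl fun x _ => Finset.sum_congr rfl fun c _ => ?_
  rw [ofCoeffs, Fin.sum_univ_castSucc]
  simp [Fin.snocEquiv, ofCoeffs]

theorem sum_monics_eq (D : ℕ) (f : F[X] → M) :
    ∑ a ∈ monics F D, f a = ∑ c : Fin D → F, f (X ^ D + ofCoeffs c) := by
  symm
  refine Finset.sum_bij (fun c _ => X ^ D + ofCoeffs c) (fun c _ => ?_) (fun c _ c' _ h => ?_)
    (fun a ha => ?_) fun _ _ => rfl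
  · rw [mem_monics]
    exact ⟨monic_X_pow_add (degree_ofCoeffs_lt c),
      natDegree_eq_of_degree_eq_some
        ((degree_add_eq_left_of_degree_lt (by rw [degree_X_pow]; exact degree_ofCoeffs_lt c)).trans
          (degree_X_pow D))⟩
  · ext i
    rw [← coeff_ofCoeffs c, add_left_cancel h, coeff_ofCoeffs]
  · rw [mem_monics] at ha
    refine ⟨fun i => a.coeff i, Finset.mem_univ _, ?_⟩
    rw [ofCoeffs, Fin.sum_univ_eq_sum_range (fun i => C (a.coeff i) * X ^ i), ← ha.2]
    exact ha.1.as_sum.symm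

/-- Summing over the top coefficient `x` replaces `g` by `∑_x (g(T + x θ^D) - g(T))`, the
subtraction being free since `q = 0` in `F`. Each difference drops the degree, so the induction
applies. -/
theorem sum_eval_ofCoeffs_eq_zero (D : ℕ) (g : F[X][X]) (hg : g.degree < D) :
    ∑ c : Fin D → F, g.eval (ofCoeffs c) = 0 := by
  induction D generalizing g with
  | zero =>
    have : g = 0 := by
      rw [← degree_eq_bot]
      exact Nat.WithBot.lt_zero_iff.1 (by exact_mod_cast hg)
    simp [this]
  | succ D ih =>
    set h : F[X][X] := ∑ x : F, taylor (C x * X ^ D) g with hh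
    have h1 : h = ∑ x : F, (taylor (C x * X ^ D) g - g) := by
      rw [Finset.sum_sub_distrib, Finset.sum_const, Finset.card_univ, nsmul_eq_mul]
      have : (q : F[X][X]) = 0 := by
        rw [← map_natCast C, ← map_natCast C, FiniteField.cast_card_eq_zero, map_zero, map_zero]
      rw [this, zero_mul, sub_zero]
    have h2 : h.degree < D := by
      rw [h1]
      refine (degree_sum_le _ _).trans_lt ((Finset.sup_lt_iff (WithBot.bot_lt_coe D)).2 fun x _ => ?_)
      rcases eq_or_ne g 0 with rfl | hg0
      · simp
      · have h3 : g.degree ≤ D := by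
          rw [degree_eq_natDegree hg0] at hg ⊢
          exact_mod_cast Nat.lt_succ_iff.1 (by exact_mod_cast hg)
        have h4 := degree_sub_lt_left (degree_taylor g (C x * X ^ D))
          (by rwa [ne_eq, taylor_eq_zero]) (leadingCoeff_taylor _ _)
        rw [degree_taylor] at h4
        exact h4.trans_le h3
    rw [sum_ofCoeffs_succ D (fun a => g.eval a), Finset.sum_comm, ← ih h h2]
    refine Finset.sum_congr rfl fun c _ => ?_
    rw [hh, eval_finsetSum]
    simp only [taylor_eval]

omit [Fintype F] in
theorem ofCoeffs_smul {D : ℕ} (x : F) (c : Fin D → F) : ofCoeffs (x • c) = C x * ofCoeffs c := by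
  rw [ofCoeffs, ofCoeffs, Finset.mul_sum]
  refine Finset.sum_congr rfl fun i _ => ?_
  rw [Pi.smul_apply, smul_eq_mul, map_mul, mul_assoc]

/-- A nonzero polynomial is a scalar times a monic one, all `q - 1` scalars contribute equally
because `q - 1 ∣ k`, and `q - 1 = -1` in `F`. The zero polynomial contributes nothing as `k ≠ 0`. -/
theorem sum_monics_pow_eq {k : ℕ} (hk : k ≠ 0) (hdvd : q - 1 ∣ k) (D : ℕ) :
    ∑ d ∈ Finset.range D, ∑ a ∈ monics F d, a ^ k = - ∑ c : Fin D → F, ofCoeffs c ^ k := by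
  classical
  induction D with
  | zero => simp [ofCoeffs, hk]
  | succ D ih =>
    have hx (x : F) : ∑ c : Fin D → F, (ofCoeffs c + C x * X ^ D) ^ k =
        ∑ a ∈ monics F D, a ^ k + if x = 0 then
          ∑ c : Fin D → F, ofCoeffs c ^ k - ∑ a ∈ monics F D, a ^ k else 0 := by
      split_ifs with h
      · simp [h]
      · obtain ⟨l, rfl⟩ := hdvd
        rw [add_zero, sum_monics_eq,
          ← Equiv.sum_comp (MulAction.toPerm (Units.mk0 x h))]
        refine Finset.sum_congr rfl fun c _ => ?_
        have h1 : MulAction.toPerm (Units.mk0 x h) c = x • c := rfl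
        rw [h1, ofCoeffs_smul, ← mul_add, mul_pow, ← map_pow, pow_mul x,
          FiniteField.pow_card_sub_one_eq_one x h, one_pow, map_one, one_mul, add_comm]
    rw [Finset.sum_range_succ, ih, sum_ofCoeffs_succ D (fun a => a ^ k)]
    simp only [hx]
    rw [Finset.sum_add_distrib, Finset.sum_const, Finset.card_univ, Finset.sum_ite_eq',
      if_pos (Finset.mem_univ _), ← Nat.cast_smul_eq_nsmul F, FiniteField.cast_card_eq_zero, zero_smul]
    abel

/-- The trivial zeros of the Carlitz-Goss zeta function. -/
theorem sum_monics_pow_eq_zero {k : ℕ} (hk : k ≠ 0) (hdvd : q - 1 ∣ k) {D : ℕ} (hD : k < D) :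
    ∑ d ∈ Finset.range D, ∑ a ∈ monics F d, a ^ k = 0 := by
  have h := sum_eval_ofCoeffs_eq_zero (F := F) D (X ^ k)
    (by rw [degree_X_pow]; exact_mod_cast hD)
  simp only [eval_pow, eval_X] at h
  rw [sum_monics_pow_eq hk hdvd, h, neg_zero]

theorem sum_pow_eq_zero {k : ℕ} (h : k = 0 ∨ ¬ q - 1 ∣ k) : ∑ x : F, x ^ k = 0 := by
  have h1 : 0 < q - 1 := Nat.sub_pos_of_lt Fintype.one_lt_card
  by_cases hk : k = 0
  · rw [hk]
    exact FiniteField.sum_pow_lt_card_sub_one F 0 h1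
  · have hd := h.resolve_left hk
    have hr : k % (q - 1) ≠ 0 := fun h => hd (Nat.dvd_of_mod_eq_zero h)
    rw [← FiniteField.sum_pow_lt_card_sub_one F (k % (q - 1)) (Nat.mod_lt _ h1)]
    refine Finset.sum_congr rfl fun x _ => ?_
    rcases eq_or_ne x 0 with rfl | hx
    · rw [zero_pow hk, zero_pow hr]
    · conv_lhs => rw [← Nat.div_add_mod k (q - 1), pow_add, pow_mul,
        FiniteField.pow_card_sub_one_eq_one x hx, one_pow, one_mul]

theorem sum_monics_eval_zero_pow {k : ℕ} (h : k = 0 ∨ ¬ q - 1 ∣ k) (n : ℕ) :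
    ∑ a ∈ monics F n, (a.eval 0) ^ k = if n = 0 then 1 else 0 := by
  rw [sum_monics_eq n (fun a => a.eval 0 ^ k)]
  cases n with
  | zero => simp [ofCoeffs]
  | succ n =>
    have h0 (c : Fin (n + 1) → F) : (X ^ (n + 1) + ofCoeffs c).eval 0 = c 0 := by
      rw [eval_add, ← coeff_zero_eq_eval_zero (ofCoeffs c)]
      simpa using coeff_ofCoeffs c 0
    simp only [h0]
    rw [← (Fin.consEquiv fun _ : Fin (n + 1) => F).sum_comp, Fintype.sum_prod_type_right]
    simp [Fin.consEquiv, sum_pow_eq_zero h]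

end PowerSums

/-- Evaluation at `t_k = θ^{q^{m_k}}`. -/
def evalFrob (F : Type*) [Field F] [Fintype F] {s : ℕ} (m : Fin s → ℕ) :
    KPoly F s →+* RatFunc F :=
  MvPolynomial.eval fun k => RatFunc.X ^ Fintype.card F ^ m k

/-- Coefficients in `F` are fixed by Frobenius, so `a(θ^{q^m}) = a(θ)^{q^m}`. -/
theorem evalFrob_prodEval (m : Fin s → ℕ) (a : F[X]) :
    evalFrob F m (prodEval F s a) = algebraMap F[X] (RatFunc F) a ^ ∑ k, q ^ m k := by
  have hfrob (l : ℕ) (x : RatFunc F) :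
      (FiniteField.frobeniusAlgHom F (RatFunc F) ^ l) x = x ^ q ^ l := by
    rw [AlgHom.coe_pow, FiniteField.coe_frobeniusAlgHom, pow_iterate]
  have hX : aeval (RatFunc.X : RatFunc F) a = algebraMap F[X] (RatFunc F) a := by
    rw [← RatFunc.algebraMap_X, aeval_algebraMap_apply, aeval_X_left_apply]
  have h1 : (evalFrob F m).comp (algebraMap F (KPoly F s)) = algebraMap F (RatFunc F) := by
    refine RingHom.ext fun c => ?_
    rw [RingHom.comp_apply, MvPolynomial.algebraMap_apply]
    exact MvPolynomial.eval_C _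
  have h2 (k : Fin s) : evalFrob F m (MvPolynomial.X k) = RatFunc.X ^ q ^ m k :=
    MvPolynomial.eval_X k
  rw [prodEval, map_prod, ← Finset.prod_pow_eq_pow_sum]
  refine Finset.prod_congr rfl fun k _ => ?_
  rw [aeval_def, hom_eval₂, h1, h2, ← aeval_def, ← hfrob, aeval_algHom_apply, hfrob, hX]

theorem evalFrob_C (m : Fin s → ℕ) (c : RatFunc F) : evalFrob F m (MvPolynomial.C c) = c :=
  MvPolynomial.eval_C c

theorem evalFrob_iterate_tau_one (m : Fin s → ℕ) {j : ℕ} (k : Fin s) (hk : m k < j) :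
    evalFrob F m ((tau F s)^[j] 1) = 0 := by
  rw [iterate_tau_eq, iterate_map_one, mul_one, map_prod]
  refine Finset.prod_eq_zero (Finset.mem_univ k) ?_
  rw [eval₂_bPoly, map_prod]
  refine Finset.prod_eq_zero (Finset.mem_range.2 hk) ?_
  rw [map_sub, evalFrob_C, sub_eq_zero]
  exact MvPolynomial.eval_X k

theorem evalFrob_iterate_tau (m : Fin s → ℕ) (j e : ℕ) :
    evalFrob F m ((tau F s)^[j] (PowerSeries.coeff e (lSeries F s))) =
      (∑ a ∈ monics F e, (algebraMap F[X] (RatFunc F) a)⁻¹ ^ q ^ j *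
        algebraMap F[X] (RatFunc F) a ^ ∑ k, q ^ m k) * evalFrob F m ((tau F s)^[j] 1) := by
  have hsum (t : Finset F[X]) (f : F[X] → KPoly F s) :
      (tau F s)^[j] (∑ a ∈ t, f a) = ∑ a ∈ t, (tau F s)^[j] (f a) := by
    induction j with
    | zero => rfl
    | succ j ih => simp only [Function.iterate_succ_apply', ih, map_sum]
  rw [coeff_lSeries, hsum, map_sum, Finset.sum_mul]
  refine Finset.sum_congr rfl fun a _ => ?_
  rw [← mul_one (prodEval F s a), prodEval_eq_map, invC, iterate_tau_C_mul, iterate_tau_map_mul,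
    ← prodEval_eq_map, map_mul, map_mul, evalFrob_C, evalFrob_prodEval, mul_assoc]

theorem evalFrob_sum_sigma (m : Fin s → ℕ) (M : ℕ) :
    evalFrob F m (∑ n ∈ Finset.range M, PowerSeries.coeff n (sigma F s)) =
      ∑ j ∈ Finset.range M, (algebraMap F[X] (RatFunc F) (carlitzD F j))⁻¹ *
        ((∑ e ∈ Finset.range (M - j), ∑ a ∈ monics F e,
          (algebraMap F[X] (RatFunc F) a)⁻¹ ^ q ^ j *
            algebraMap F[X] (RatFunc F) a ^ ∑ k, q ^ m k) *
          evalFrob F m ((tau F s)^[j] 1)) := by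
  simp only [sigma, coeff_expZ, Finset.Nat.sum_antidiagonal_eq_sum_range_succ_mk]
  rw [Finset.sum_range_diag_flip M fun j e => invC F s (carlitzD F j) *
    (tau F s)^[j] (PowerSeries.coeff e (lSeries F s)), map_sum]
  refine Finset.sum_congr rfl fun j _ => ?_
  rw [← Finset.mul_sum, map_mul, invC, evalFrob_C, map_sum, Finset.sum_mul]
  simp only [evalFrob_iterate_tau]

theorem sum_inv_pow_mul_pow_eq {j N : ℕ} (h : q ^ j ≤ N) (D : ℕ) :
    ∑ e ∈ Finset.range D, ∑ a ∈ monics F e,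
      (algebraMap F[X] (RatFunc F) a)⁻¹ ^ q ^ j * algebraMap F[X] (RatFunc F) a ^ N =
    algebraMap F[X] (RatFunc F)
      (∑ e ∈ Finset.range D, ∑ a ∈ monics F e, a ^ (N - q ^ j)) := by
  rw [map_sum]
  refine Finset.sum_congr rfl fun e _ => ?_
  rw [map_sum]
  refine Finset.sum_congr rfl fun a ha => ?_
  have h0 : algebraMap F[X] (RatFunc F) a ≠ 0 :=
    (map_ne_zero_iff _ (IsFractionRing.injective _ _)).2 ((mem_monics F e a).1 ha).1.ne_zero
  rw [map_pow, inv_pow, inv_mul_eq_iff_eq_mul₀ (pow_ne_zero _ h0), ← pow_add,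
    Nat.add_sub_cancel' h]

theorem pow_card_modEq_one (j : ℕ) : q ^ j ≡ 1 [MOD q - 1] := by
  have h : q ≡ 1 [MOD q - 1] := by
    have h1 : 1 ≤ q := Fintype.card_pos
    exact ((Nat.modEq_iff_dvd' h1).2 dvd_rfl).symm
  simpa using h.pow j

/-- At `t_k = θ^{q^{m_k}}` the `j`-th term dies through `b_j(t_k)` if some `m_k < j`. Otherwise it
contains the power sum of exponent `∑ q^{m_k} - q^j`, which is positive (as `s > 1`) and divisible
by `q - 1` (as `s ≡ 1`). -/
theorem eval_one_sigma_eq_zero (hs : 1 < s) (hmod : s ≡ 1 [MOD q - 1])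
    {σ : Polynomial (MvPolynomial (Fin s) F[X])}
    (hσ : (σ.map (incl F s) : PowerSeries (KPoly F s)) = sigma F s) : σ.eval 1 = 0 := by
  apply incl_injective (F := F)
  rw [map_zero]
  refine MvPolynomial.funext_set (fun _ => Set.range fun i : ℕ => RatFunc.X ^ q ^ i)
    (fun _ => Set.infinite_range_of_injective ?_) fun x hx => ?_
  · intro i j hij
    have hij : (RatFunc.X : RatFunc F) ^ q ^ i = RatFunc.X ^ q ^ j := hij
    rw [← RatFunc.algebraMap_X, ← map_pow, ← map_pow] at hij
    have h1 := congrArg natDegree (IsFractionRing.injective F[X] (RatFunc F) hij)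
    rw [natDegree_X_pow, natDegree_X_pow] at h1
    exact Nat.pow_right_injective Fintype.one_lt_card h1
  · rw [map_zero]
    have hx' (k : Fin s) : ∃ i : ℕ, RatFunc.X ^ q ^ i = x k := hx k (Set.mem_univ k)
    choose m hm using hx'
    obtain rfl : (fun k => RatFunc.X ^ q ^ m k) = x := funext hm
    change evalFrob F m _ = 0
    -- `M` exceeds `s`, so it covers all of `σ_s`, and since `j ≤ ∑ m_k` the inner range `M - j`
    -- exceeds the exponent of the power sum.
    rw [incl_eval_one_sigma hσ (M := s + (∑ k, q ^ m k) + (∑ k, m k) + 1) (by omega),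
      evalFrob_sum_sigma]
    refine Finset.sum_eq_zero fun j _ => ?_
    by_cases h : ∃ k, m k < j
    · obtain ⟨k, hk⟩ := h
      rw [evalFrob_iterate_tau_one m k hk, mul_zero, mul_zero]
    · push Not at h
      have hle : s * q ^ j ≤ ∑ k, q ^ m k := by
        have h1 := Finset.card_nsmul_le_sum Finset.univ (fun k => q ^ m k) (q ^ j)
          fun k _ => Nat.pow_le_pow_right Fintype.card_pos (h k)
        simpa using h1
      have hpos : 0 < q ^ j := pow_pos Fintype.card_pos j
      have hlt : q ^ j < ∑ k, q ^ m k := by nlinarith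
      have hj : j ≤ ∑ k, m k :=
        (h ⟨0, by omega⟩).trans (Finset.single_le_sum (fun _ _ => Nat.zero_le _) (Finset.mem_univ _))
      have hdvd : q - 1 ∣ ∑ k, q ^ m k - q ^ j := by
        refine (Nat.modEq_iff_dvd' hlt.le).1 ?_
        have h1 : ∑ k : Fin s, q ^ m k ≡ ∑ k : Fin s, 1 [MOD q - 1] :=
          Nat.ModEq.sum fun k _ => pow_card_modEq_one (m k)
        rw [Finset.sum_const, Finset.card_univ, Fintype.card_fin, smul_eq_mul, mul_one] at h1
        exact (pow_card_modEq_one j).trans (h1.trans hmod).symm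
      rw [sum_inv_pow_mul_pow_eq hlt.le, sum_monics_pow_eq_zero (by omega) hdvd (by omega),
        map_zero, zero_mul, mul_zero]

/-- At `t_k = θ` only `j = 0` survives, leaving `∑ a^{s-1}` over monic `a` of degree at most `s`.
Setting `θ = 0`, degree zero gives `1` and every positive degree gives `0`, as `∑_{x ∈ F} x^{s-1} =
0` (for `s = 1` this sum is `q`, with `0^0 = 1`). -/
theorem eval_one_sigma_ne_zero (hs : 1 ≤ s) (h : ¬ (1 < s ∧ s ≡ 1 [MOD q - 1]))
    {σ : Polynomial (MvPolynomial (Fin s) F[X])}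
    (hσ : (σ.map (incl F s) : PowerSeries (KPoly F s)) = sigma F s) : σ.eval 1 ≠ 0 := by
  intro h0
  have h1 := congrArg (evalFrob F fun _ => 0) (incl_eval_one_sigma hσ (Nat.lt_succ_self s))
  rw [h0, map_zero, map_zero, evalFrob_sum_sigma, Finset.sum_range_succ', Finset.sum_eq_zero
    fun j _ => by rw [evalFrob_iterate_tau_one _ ⟨0, hs⟩ (Nat.succ_pos j), mul_zero, mul_zero],
    sum_inv_pow_mul_pow_eq (by simpa using hs)] at h1
  simp only [carlitzD, map_one, inv_one, one_mul, zero_add, Function.iterate_zero, id, mul_one,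
    Nat.sub_zero, pow_zero, Finset.sum_const, Finset.card_univ, Fintype.card_fin, smul_eq_mul]
    at h1
  have h2 := (map_eq_zero_iff _ (IsFractionRing.injective F[X] (RatFunc F))).1 h1.symm
  have h3 := congrArg (Polynomial.eval 0) h2
  have hk : s - 1 = 0 ∨ ¬ q - 1 ∣ s - 1 := by
    by_contra! hc
    exact h ⟨by omega, ((Nat.modEq_iff_dvd' hs).2 hc.2).symm⟩
  simp only [eval_finsetSum, eval_pow, sum_monics_eval_zero_pow hk] at h3
  simp at h3

end ValueAtOne

end AndersonStark

end

theorem mainTheorem8 (F : Type*) [Field F] [Fintype F] (s : ℕ) (hs : 1 ≤ s) :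
    ∃ σ S : Polynomial (MvPolynomial (Fin s) (Polynomial F)),
      (σ.map (AndersonStark.incl F s) : PowerSeries (AndersonStark.KPoly F s)) =
          AndersonStark.sigma F s ∧
      (S.map (AndersonStark.incl F s) : PowerSeries (AndersonStark.KPoly F s)) =
          AndersonStark.specialS F s ∧
      (σ.natDegree : ℚ) ≤ ((s : ℚ) - 1) / ((Fintype.card F : ℚ) - 1) ∧
      (Polynomial.X - 1 ∣ σ ↔ S.eval 1 = 0) ∧
      (Polynomial.X - 1 ∣ σ ↔ 1 < s ∧ s ≡ 1 [MOD Fintype.card F - 1]) := by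
  obtain ⟨σ, hσ⟩ := AndersonStark.exists_sigma_polynomial (F := F) (s := s)
  obtain ⟨S, hS, hS1⟩ := AndersonStark.exists_specialS_polynomial (F := F) (s := s)
  have hdvd : Polynomial.X - 1 ∣ σ ↔ σ.eval 1 = 0 := by
    rw [← map_one C]
    exact dvd_iff_isRoot
  refine ⟨σ, S, hσ, hS, AndersonStark.natDegree_sigma_le hs hσ, ?_, ?_⟩
  · rw [hdvd, ← map_eq_zero_iff _ (AndersonStark.incl_injective (F := F) (s := s)),
      AndersonStark.incl_eval_one_sigma hσ (Nat.lt_succ_self s),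
      ← map_eq_zero_iff (AndersonStark.incl F s) AndersonStark.incl_injective, hS1,
      AndersonStark.carlitzTensor_eq_zero_iff]
  · rw [hdvd]
    refine ⟨fun h => ?_, fun h => AndersonStark.eval_one_sigma_eq_zero h.1 h.2 hσ⟩
    by_contra hc
    exact AndersonStark.eval_one_sigma_ne_zero hs hc hσ h
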